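/- We work over $\mathbb{C}$. A plane curve of degree $d$ is an effective divisor $C=\{F=0\}\subset\mathbb{P}^2$ given by a non-zero form $F$ of degree $d$; it may be reducible or non-reduced. A point $p\in C$ is a $[3;3]$-point if $C$ has an isolated singularity of multiplicity exactly $3$ at $p$ and the strict transform of $C$ in the blow-up of $\mathbb{P}^2$ at $p$ has a point of multiplicity exactly $3$ on the exceptional line. That point of the exceptional line corresponds to a tangent direction at $p$; the line through $p$ in this direction is the distinguished tangent line $L_p$. A curve $\{Q=0\}$ passes through $p$ in distinguished tangent direction if $Q$ vanishes at $p$ and its differential at $p$ vanishes along $L_p$. Proposition A.5. (a) If a plane curve has a $[3;3]$-point, then its degree is at least $5$. (b) If a plane curve has three distinct $[3;3]$-points, then its degree is at least $8$. (c) Let $C=\{F=0\}$ be a plane octic (degree $8$) with three distinct $[3;3]$-points $p_1,p_2,p_3$, and let $D=\{Q=0\}$ be a conic ($Q\neq 0$ a quadratic form) which passes through each of $p_1,p_2,p_3$ in distinguished tangent direction. Then $C$ contains $D$, i.e. $Q$ divides $F$. (d) No plane octic has four distinct $[3;3]$-points. -/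

import Mathlib

/-!
Plane curves over the complex numbers and their `[n;n]`-points.  A plane curve of degree `d`,
possibly reducible or non-reduced, is given by a non-zero form of degree `d` in three variables.
-/

namespace PlaneCurves

open MvPolynomial Topology

/-- The complex projective plane. -/
abbrev ProjPlane : Type := Projectivization ℂ (Fin 3 → ℂ)

/-- `F` is the equation of a (possibly non-reduced) plane curve of degree `d`. -/
def IsPlaneCurve (d : ℕ) (F : MvPolynomial (Fin 3) ℂ) : Prop :=
  F.IsHomogeneous d ∧ F ≠ 0

/-! ### Germs at the origin of the affine plane -/

/-- The origin is an `n`-fold point of `f = 0`: `f` lies in `(x, y)^n` but not in `(x, y)^(n+1)`. -/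
def IsNFold (n : ℕ) (f : MvPolynomial (Fin 2) ℂ) : Prop :=
  f ∈ idealOfVars (Fin 2) ℂ ^ n ∧ f ∉ idealOfVars (Fin 2) ℂ ^ (n + 1)

/-- The curve `f = 0` has at most an isolated singularity at the origin: some punctured
neighbourhood of the origin (in the classical topology) contains no singular point of `f = 0`. -/
def IsIsolated (f : MvPolynomial (Fin 2) ℂ) : Prop :=
  ∀ᶠ q in 𝓝[≠] (0 : Fin 2 → ℂ), ¬ (eval q f = 0 ∧ ∀ i, eval q (pderiv i f) = 0)

/-- `g = 0` is the strict transform of `f = 0` in the chart `(x, y) ↦ (x, x * y)` of the blow-up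
of the affine plane in the origin: the total transform `f (x, x * y)` with the exceptional line
`x = 0` removed as often as it occurs.  The origin of this chart is the point of the exceptional
line which corresponds to the direction of the `x`-axis. -/
def IsStrictTransform (f g : MvPolynomial (Fin 2) ℂ) : Prop :=
  (∃ m : ℕ, bind₁ ![X 0, X 0 * X 1] f = X 0 ^ m * g) ∧ ¬ (X 0 ∣ g)

/-- The germ of `f = 0` at the origin is an `[n;n]`-point whose infinitely near `n`-fold point lies
in the direction of the `x`-axis. -/
def IsNNGerm (n : ℕ) (f : MvPolynomial (Fin 2) ℂ) : Prop :=
  IsIsolated f ∧ IsNFold n f ∧ ∃ g, IsStrictTransform f g ∧ IsNFold n g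

/-! ### Points of plane curves -/

/-- The equation of the curve `F = 0` in the affine coordinates `(x, y) ↦ [P + x v + y w]`, which
are centred at the point `[P]` if `P, v, w` is a basis. -/
noncomputable def affineEquation (F : MvPolynomial (Fin 3) ℂ) (P v w : Fin 3 → ℂ) :
    MvPolynomial (Fin 2) ℂ :=
  aeval (fun i => C (P i) + C (v i) * X 0 + C (w i) * X 1) F

/-- The point `p` is an `[n;n]`-point of the curve `F = 0`, and its distinguished tangent line is
`L` (given by the corresponding plane in `ℂ³`).  This is tested in affine coordinates
centred at `p` whose `x`-axis is `L`. -/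
def IsNNPointWithTangent (n : ℕ) (F : MvPolynomial (Fin 3) ℂ) (p : ProjPlane)
    (L : Submodule ℂ (Fin 3 → ℂ)) : Prop :=
  ∃ P v w : Fin 3 → ℂ, LinearIndependent ℂ ![P, v, w] ∧
    p.submodule = Submodule.span ℂ {P} ∧ L = Submodule.span ℂ {P, v} ∧
    IsNNGerm n (affineEquation F P v w)

/-- The point `p` is an `[n;n]`-point of the curve `F = 0`. -/
def IsNNPoint (n : ℕ) (F : MvPolynomial (Fin 3) ℂ) (p : ProjPlane) : Prop :=
  ∃ L, IsNNPointWithTangent n F p L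

/-- The curve `Q = 0` passes through the point `p` in the direction of the line `L` through `p`:
it contains `p`, and the differential of `Q` at `p` vanishes along `L`.  (If the curve is smooth
at `p`, then `L` is its tangent line; a curve which is singular at `p` passes through `p` in every
direction.) -/
def PassesInDirection (Q : MvPolynomial (Fin 3) ℂ) (p : ProjPlane)
    (L : Submodule ℂ (Fin 3 → ℂ)) : Prop :=
  eval p.rep Q = 0 ∧ ∀ v ∈ L, ∑ i, eval p.rep (pderiv i Q) * v i = 0

end PlaneCurves

/-!
In affine coordinates adapted to its distinguished tangent, a `[3;3]`-point is a Newton polygon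
condition: every monomial `x ^ a * y ^ b` of the equation satisfies `a + 2 * b ≥ 6`, and `y ^ 3`
occurs (`IsNNGerm.newtonPolygon`). So the equation has weight `6` if `x` has weight `1` and `y` has
weight `2`; isolatedness is used only to exclude multiple components through the point
(`IsTriplePoint.not_sq_dvd`). All intersection numbers are replaced by orders of vanishing and
degrees of polynomials in one variable: restricted to a parametrized curve, the equation vanishes to
order `6` along a smooth branch in the distinguished direction and to order `3` along a transverse
one (`VanishesAt.pow_dvd`, and `VanishesAt.natDegree_add_le` at the parameter `∞`). If the total
order exceeds the degree, the curve is a component; since a factor which is smooth at the point takes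
away weight at most `2` (`IsTriplePoint.vanishesAt_of_mul`), the same count for the residual curve
often shows that it is a double component, which is impossible.

* In degree at most `4` the weight condition makes the distinguished tangent a double component
  (`IsTriplePoint.five_le`).
* In degree at most `8` this argument for lines shows that the points are in general position: no
  three of them are collinear and no distinguished tangent contains a second point
  (`IsTriplePoint.det3_ne_zero`, `IsTriplePoint.det3_tangent_ne_zero`). So for three points there is
  a smooth conic which touches two distinguished tangents and passes through the third point, and
  coordinates in which it is `y ^ 2 = x * z` (`exists_normalForm`). The equation vanishes on it to
  order `6 + 6 + 3 = 15 > 2 * 7`, which settles degree at most `7` (`not_three_isTriplePoint`). If it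
  touches all three tangents, the order is `18 > 2 * 8`, so an octic contains it
  (`dvd_of_vanishesAt`). A conic through four points which touches two tangents would even be a double
  component of an octic (`not_conic_of_four_isTriplePoint`).
* Suppose that an octic has four `[3;3]`-points, and take the first three as coordinate points and the
  fourth as the unit point. The standard quadratic transformation turns the directions at the
  coordinate points into points `q₁`, `q₂`, `q₃` on the coordinate lines. If these are not collinear,
  there is a conic through them which touches the direction at the unit point. Its image under the
  transformation is a rational quartic with two branches at each coordinate point, one in the
  distinguished direction and one transverse to it. The octic vanishes on it to order at least
  `3 * (6 + 3) + 6 = 33 > 4 * 8` (`aeval_eq_zero_of_parametrization`), and so it contains the quartic;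
  but it does not contain a transverse branch, and this contradiction shows that `q₁`, `q₂`, `q₃` are
  collinear (`normal_relation`). Without coordinates, if `D i j` is the determinant of the `i`-th
  point, its direction and the `j`-th point, this says `D i j * D j k * D k i = D i k * D k j * D j i`
  (`det3_relation`). As this holds for all triples, the vectors can be rescaled so that `D` is
  symmetric. Together with the linear relation between the four points, the symmetry produces a conic
  through all four points which touches two distinguished tangents, and this was excluded
  (`not_isTriplePoint_of_symmetric`, `not_four_isTriplePoint`).
-/

namespace PlaneCurves

open MvPolynomial Topology
open scoped Polynomial

/-! ### Linear substitutions and weights -/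

/-- A linear map which sends every monomial to a monomial preserves the coefficient of each
monomial whose image is attained only once. -/
lemma coeff_map_monomial {σ τ : Type*} (φ : MvPolynomial σ ℂ →ₗ[ℂ] MvPolynomial τ ℂ)
    (e : (σ →₀ ℕ) → (τ →₀ ℕ)) (hφ : ∀ m c, φ (monomial m c) = monomial (e m) c)
    (f : MvPolynomial σ ℂ) (m : σ →₀ ℕ) (hm : ∀ m' ∈ f.support, e m' = e m → m' = m) :
    coeff (e m) (φ f) = coeff m f := by
  classical
  conv_lhs => rw [f.as_sum, map_sum, coeff_sum]
  simp only [hφ, coeff_monomial]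
  rw [Finset.sum_eq_single m]
  · simp
  · intro b hb hbm
    rw [if_neg (fun h => hbm (hm b hb h))]
  · intro h
    simpa using h

lemma exists_mem_support_of_coeff_map_ne_zero {σ τ : Type*}
    (φ : MvPolynomial σ ℂ →ₗ[ℂ] MvPolynomial τ ℂ)
    (e : (σ →₀ ℕ) → (τ →₀ ℕ)) (hφ : ∀ m c, φ (monomial m c) = monomial (e m) c)
    (f : MvPolynomial σ ℂ) (n : τ →₀ ℕ) (hn : coeff n (φ f) ≠ 0) :
    ∃ m ∈ f.support, e m = n := by
  classical
  by_contra! h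
  apply hn
  rw [f.as_sum, map_sum, coeff_sum]
  refine Finset.sum_eq_zero fun m hm => ?_
  rw [hφ, coeff_monomial, if_neg (h m hm)]

/-- The form `F` in the coordinates given by the columns of the matrix `M`. -/
noncomputable def pull (M : Matrix (Fin 3) (Fin 3) ℂ) (F : MvPolynomial (Fin 3) ℂ) :
    MvPolynomial (Fin 3) ℂ :=
  bind₁ M.toMvPolynomial F

lemma pull_mul (M : Matrix (Fin 3) (Fin 3) ℂ) (F G : MvPolynomial (Fin 3) ℂ) :
    pull M (F * G) = pull M F * pull M G := map_mul _ _ _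

lemma pull_pull (M N : Matrix (Fin 3) (Fin 3) ℂ) (F : MvPolynomial (Fin 3) ℂ) :
    pull N (pull M F) = pull (M * N) F := by
  rw [pull, pull, pull, bind₁_bind₁]
  congr 2
  funext i
  exact (Matrix.toMvPolynomial_mul M N i).symm

lemma pull_one (F : MvPolynomial (Fin 3) ℂ) : pull 1 F = F := by
  rw [pull, Matrix.toMvPolynomial_one, bind₁_X_left]; rfl

lemma aeval_pull {R : Type*} [CommRing R] [Algebra ℂ R] (M : Matrix (Fin 3) (Fin 3) ℂ)
    (F : MvPolynomial (Fin 3) ℂ) (γ : Fin 3 → R) :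
    aeval γ (pull M F) = aeval ((M.map (algebraMap ℂ R)).mulVec γ) F := by
  rw [pull, aeval_bind₁]
  congr 2
  funext i
  simp only [Matrix.toMvPolynomial, map_sum, aeval_monomial, Matrix.mulVec, dotProduct]
  simp

lemma eval_pull (M : Matrix (Fin 3) (Fin 3) ℂ) (F : MvPolynomial (Fin 3) ℂ) (x : Fin 3 → ℂ) :
    eval x (pull M F) = eval (M.mulVec x) F := by
  have := aeval_pull M F x
  simpa [aeval_eq_eval, Matrix.map_id] using this

lemma isHomogeneous_pull {d : ℕ} (M : Matrix (Fin 3) (Fin 3) ℂ) {F : MvPolynomial (Fin 3) ℂ}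
    (hF : F.IsHomogeneous d) : (pull M F).IsHomogeneous d := by
  have := MvPolynomial.IsHomogeneous.aeval hF M.toMvPolynomial
    (fun i => M.toMvPolynomial_isHomogeneous i)
  rwa [one_mul] at this

lemma pull_ne_zero {M : Matrix (Fin 3) (Fin 3) ℂ} (hM : M.det ≠ 0) {F : MvPolynomial (Fin 3) ℂ}
    (hF : F ≠ 0) : pull M F ≠ 0 := by
  intro h
  apply hF
  have : pull M⁻¹ (pull M F) = F := by
    rw [pull_pull, Matrix.mul_nonsing_inv _ (isUnit_iff_ne_zero.2 hM), pull_one]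
  rw [← this, h, pull, map_zero]

lemma isPlaneCurve_pull {d : ℕ} {M : Matrix (Fin 3) (Fin 3) ℂ} (hM : M.det ≠ 0)
    {F : MvPolynomial (Fin 3) ℂ} (hF : IsPlaneCurve d F) : IsPlaneCurve d (pull M F) :=
  ⟨isHomogeneous_pull M hF.1, pull_ne_zero hM hF.2⟩

lemma pull_dvd_pull_iff {M : Matrix (Fin 3) (Fin 3) ℂ} (hM : M.det ≠ 0)
    {F G : MvPolynomial (Fin 3) ℂ} : pull M F ∣ pull M G ↔ F ∣ G := by
  constructor
  · rintro ⟨H, hH⟩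
    refine ⟨pull M⁻¹ H, ?_⟩
    have := congrArg (pull M⁻¹) hH
    rwa [pull_mul, pull_pull, pull_pull, Matrix.mul_nonsing_inv _ (isUnit_iff_ne_zero.2 hM),
      pull_one, pull_one] at this
  · rintro ⟨H, rfl⟩
    exact ⟨pull M H, pull_mul _ _ _⟩

lemma degree_fin_three (m : Fin 3 →₀ ℕ) : m.degree = m 0 + m 1 + m 2 := by
  rw [Finsupp.degree_eq_sum, Fin.sum_univ_three]

lemma sum_of_mem_support {d : ℕ} {F : MvPolynomial (Fin 3) ℂ} (hF : F.IsHomogeneous d)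
    {m : Fin 3 →₀ ℕ} (hm : m ∈ F.support) : m 0 + m 1 + m 2 = d := by
  rw [← degree_fin_three]
  rw [Finsupp.degree_eq_weight_one]
  exact hF (mem_support_iff.1 hm)

/-- The form `G` has order at least `n` with respect to the weights `0, 1, 2` of the variables.
In coordinates adapted to a point and a direction this is the order of `G` along the
exceptional curve of the second of the two corresponding blow-ups. -/
def WeightGE (n : ℕ) (G : MvPolynomial (Fin 3) ℂ) : Prop :=
  ∀ m ∈ G.support, n ≤ m 1 + 2 * m 2

/-- The substitution whose divisibility by powers of the new variable measures the weight. -/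
noncomputable def weightHom : MvPolynomial (Fin 3) ℂ →ₐ[ℂ] (MvPolynomial (Fin 3) ℂ)[X] :=
  aeval ![Polynomial.C (X 0), Polynomial.C (X 1) * Polynomial.X,
    Polynomial.C (X 2) * Polynomial.X ^ 2]

lemma weightHom_monomial (m : Fin 3 →₀ ℕ) (c : ℂ) :
    weightHom (monomial m c) = Polynomial.monomial (m 1 + 2 * m 2) (monomial m c) := by
  have h : (monomial m c : MvPolynomial (Fin 3) ℂ) = C c * (X 0 ^ m 0 * X 1 ^ m 1 * X 2 ^ m 2) := by
    rw [monomial_eq, Finsupp.prod_fintype _ _ (by simp), Fin.prod_univ_three]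
  rw [weightHom, aeval_monomial, Finsupp.prod_fintype _ _ (by simp), Fin.prod_univ_three,
    ← Polynomial.C_mul_X_pow_eq_monomial, h]
  have : (algebraMap ℂ (MvPolynomial (Fin 3) ℂ)[X]) c = Polynomial.C (C c) := rfl
  rw [this]
  simp only [Matrix.cons_val, map_mul, map_pow]
  ring

lemma weightGE_iff (n : ℕ) (G : MvPolynomial (Fin 3) ℂ) :
    WeightGE n G ↔ Polynomial.X ^ n ∣ weightHom G := by
  classical
  have key : weightHom G = ∑ m ∈ G.support,
      Polynomial.monomial (m 1 + 2 * m 2) (monomial m (coeff m G)) := by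
    conv_lhs => rw [G.as_sum, map_sum]
    simp only [weightHom_monomial]
  rw [Polynomial.X_pow_dvd_iff]
  constructor
  · intro h k hk
    rw [key, Polynomial.finsetSum_coeff]
    refine Finset.sum_eq_zero fun m hm => ?_
    rw [Polynomial.coeff_monomial, if_neg]
    have := h m hm
    lia
  · intro h m hm
    by_contra! hlt
    have h0 := congrArg (coeff m) (h _ hlt)
    rw [key, Polynomial.finsetSum_coeff, coeff_sum, Finset.sum_eq_single m] at h0
    · rw [Polynomial.coeff_monomial, if_pos rfl, coeff_monomial, if_pos rfl] at h0
      exact (mem_support_iff.1 hm) (by simpa using h0)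
    · intro b _ hb
      rw [Polynomial.coeff_monomial]
      split_ifs
      · rw [coeff_monomial, if_neg hb]
      · simp
    · intro h; exact absurd hm h

/-- Weights are additive: a factor of small weight leaves a cofactor of large weight. -/
lemma WeightGE.of_mul {n k : ℕ} {A B : MvPolynomial (Fin 3) ℂ} (h : WeightGE (n + k) (A * B))
    (hA : ¬ WeightGE (k + 1) A) : WeightGE n B := by
  rw [weightGE_iff] at *
  rw [map_mul] at h
  have hA0 : weightHom A ≠ 0 := fun h0 => hA (by rw [h0]; exact dvd_zero _)
  obtain ⟨A₁, hA₁, hnd⟩ :=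
    Polynomial.exists_eq_pow_rootMultiplicity_mul_and_not_dvd (weightHom A) hA0 0
  set j := (weightHom A).rootMultiplicity 0
  rw [Polynomial.C_0, sub_zero] at hA₁ hnd
  have hj : j ≤ k := by
    by_contra! hlt
    exact hA (by rw [hA₁]; exact (pow_dvd_pow _ hlt).mul_right _)
  rw [hA₁, mul_assoc, show n + k = j + (n + k - j) by lia, pow_add] at h
  have h1 := (mul_dvd_mul_iff_left (pow_ne_zero j Polynomial.X_ne_zero)).1 h
  have h2 := Polynomial.prime_X.pow_dvd_of_dvd_mul_left _ hnd h1
  exact (pow_dvd_pow _ (by lia)).trans h2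

/-! ### Equations of `[3;3]`-points -/

lemma X_pow_dvd_of_forall_mem_support {σ : Type*} {i : σ} {n : ℕ} {p : MvPolynomial σ ℂ}
    (h : ∀ m ∈ p.support, n ≤ m i) : X i ^ n ∣ p := by
  rw [p.as_sum]
  refine Finset.dvd_sum fun m hm => ?_
  rw [X_pow_eq_monomial, monomial_dvd_monomial]
  exact ⟨Or.inr (Finsupp.single_le_iff.2 (h m hm)), one_dvd _⟩

lemma X_dvd_of_forall_mem_support {σ : Type*} {i : σ} {p : MvPolynomial σ ℂ}
    (h : ∀ m ∈ p.support, m i ≠ 0) : X i ∣ p := by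
  rw [← pow_one (X i)]
  exact X_pow_dvd_of_forall_mem_support fun m hm => Nat.one_le_iff_ne_zero.2 (h m hm)

lemma degree_fin_two (m : Fin 2 →₀ ℕ) : m.degree = m 0 + m 1 := by
  rw [Finsupp.degree_eq_sum, Fin.sum_univ_two]

/-- In coordinates adapted to its distinguished tangent, a `[3;3]`-point is described by the
Newton polygon: only monomials `x ^ a * y ^ b` with `a + 2 * b ≥ 6` occur, and `y ^ 3` does. -/
lemma IsNNGerm.newtonPolygon {f : MvPolynomial (Fin 2) ℂ} (hf : IsNNGerm 3 f) :
    (∀ n ∈ f.support, 6 ≤ n 0 + 2 * n 1) ∧ ∃ n ∈ f.support, n 0 = 0 ∧ n 1 = 3 := by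
  classical
  obtain ⟨-, ⟨hf3, hf4⟩, g, ⟨⟨m, hm⟩, hX⟩, hg3, -⟩ := hf
  rw [mem_pow_idealOfVars_iff] at hf3 hf4 hg3
  simp only [degree_fin_two] at hf3 hf4 hg3
  push Not at hf4
  let e : (Fin 2 →₀ ℕ) → (Fin 2 →₀ ℕ) := fun n =>
    Finsupp.single 0 (n 0 + n 1) + Finsupp.single 1 (n 1)
  have e0 : ∀ n, e n 0 = n 0 + n 1 := fun n => by simp [e]
  have e1 : ∀ n, e n 1 = n 1 := fun n => by simp [e]
  let T : MvPolynomial (Fin 2) ℂ →ₗ[ℂ] MvPolynomial (Fin 2) ℂ :=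
    (bind₁ ![X 0, X 0 * X 1]).toLinearMap
  have hT : ∀ n c, T (monomial n c) = monomial (e n) c := by
    intro n c
    change bind₁ _ _ = _
    rw [bind₁_monomial, monomial_eq, Finsupp.prod_fintype _ _ (by simp), Fin.prod_univ_two,
      ← Finsupp.prod, Finsupp.prod_fintype _ _ (by simp), Fin.prod_univ_two, e0, e1]
    simp only [Matrix.cons_val]
    ring
  have hTf : T f = monomial (Finsupp.single 0 m) 1 * g := by
    rw [← X_pow_eq_monomial]; exact hm
  have einj : ∀ n n', e n' = e n → n' = n := by
    intro n n' h
    have h0 := DFunLike.congr_fun h 0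
    have h1 := DFunLike.congr_fun h 1
    rw [e0, e0] at h0
    rw [e1, e1] at h1
    ext i
    fin_cases i
    · change n' 0 = n 0; lia
    · exact h1
  have hcoef : ∀ n, coeff (e n) (T f) = coeff n f := fun n =>
    coeff_map_monomial T e hT f n (fun n' _ => einj n n')
  have hle : ∀ n ∈ f.support, m ≤ n 0 + n 1 ∧ ∃ s ∈ g.support, s 0 + m = n 0 + n 1 ∧ s 1 = n 1 := by
    intro n hn
    rw [mem_support_iff, ← hcoef, hTf, coeff_monomial_mul'] at hn
    split_ifs at hn with hs
    · rw [one_mul] at hn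
      have h0 := hs 0
      rw [e0, Finsupp.single_eq_same] at h0
      refine ⟨h0, _, mem_support_iff.2 hn, ?_, ?_⟩
      · rw [Finsupp.tsub_apply, e0, Finsupp.single_eq_same]; lia
      · rw [Finsupp.tsub_apply, e1]; simp
    · exact absurd rfl hn
  obtain ⟨n₃, hn₃, hlt⟩ := hf4
  have hn₃' := hf3 n₃ hn₃
  have hm3 : m ≤ 3 := by have := (hle n₃ hn₃).1; lia
  have h3m : 3 ≤ m := by
    obtain ⟨s, hs, hs0⟩ : ∃ s ∈ g.support, s 0 = 0 := by
      by_contra! hall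
      exact hX (X_dvd_of_forall_mem_support hall)
    have : coeff (Finsupp.single 0 m + s) (T f) ≠ 0 := by
      rw [hTf, coeff_monomial_mul, one_mul]; exact mem_support_iff.1 hs
    obtain ⟨n, hn, hen⟩ := exists_mem_support_of_coeff_map_ne_zero T e hT f _ this
    have h0 := DFunLike.congr_fun hen 0
    rw [e0, Finsupp.add_apply, Finsupp.single_eq_same, hs0] at h0
    have := hf3 n hn
    lia
  have key : ∀ n ∈ f.support, 6 ≤ n 0 + 2 * n 1 := by
    intro n hn
    obtain ⟨-, s, hs, h0, h1⟩ := hle n hn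
    have := hg3 s hs
    lia
  refine ⟨key, n₃, hn₃, ?_, ?_⟩ <;> have := key n₃ hn₃ <;> lia

/-- The affine equation of a form, as in the chart where the first variable is `1`. -/
noncomputable def dehom : MvPolynomial (Fin 3) ℂ →ₐ[ℂ] MvPolynomial (Fin 2) ℂ :=
  aeval ![1, X 0, X 1]

lemma dehom_monomial (m : Fin 3 →₀ ℕ) (c : ℂ) :
    dehom (monomial m c) = monomial (Finsupp.tail m) c := by
  rw [dehom, aeval_monomial, Finsupp.prod_fintype _ _ (by simp), Fin.prod_univ_three, monomial_eq,
    Finsupp.prod_fintype _ _ (by simp), Fin.prod_univ_two, Finsupp.tail_apply, Finsupp.tail_apply]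
  simp [algebraMap_eq]

lemma newtonPolygon_of_isNNGerm_dehom {d : ℕ} {G : MvPolynomial (Fin 3) ℂ}
    (hG : G.IsHomogeneous d) (h : IsNNGerm 3 (dehom G)) :
    WeightGE 6 G ∧ ∃ m ∈ G.support, m 1 = 0 ∧ m 2 = 3 := by
  obtain ⟨h1, n, hn, hn0, hn1⟩ := h.newtonPolygon
  constructor
  · intro m hm
    refine h1 (Finsupp.tail m) ?_
    rw [mem_support_iff]
    have := coeff_map_monomial dehom.toLinearMap Finsupp.tail dehom_monomial G m ?_
    · exact this ▸ mem_support_iff.1 hm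
    · intro m' hm' hmm
      have hs := sum_of_mem_support hG hm
      have hs' := sum_of_mem_support hG hm'
      have h1 := DFunLike.congr_fun hmm 0
      have h2 := DFunLike.congr_fun hmm 1
      simp only [Finsupp.tail_apply] at h1 h2
      change m' 1 = m 1 at h1
      change m' 2 = m 2 at h2
      ext i
      fin_cases i
      · change m' 0 = m 0; lia
      · exact h1
      · exact h2
  · obtain ⟨m, hm, rfl⟩ := exists_mem_support_of_coeff_map_ne_zero dehom.toLinearMap Finsupp.tail
      dehom_monomial G n (mem_support_iff.1 hn)
    exact ⟨m, hm, hn0, hn1⟩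

/-- The columns of `M` are homogeneous coordinates for `F` in which the first coordinate point is
a `[3;3]`-point of `F = 0` whose distinguished tangent is the first coordinate axis. -/
structure IsGerm (F : MvPolynomial (Fin 3) ℂ) (M : Matrix (Fin 3) (Fin 3) ℂ) : Prop where
  det_ne_zero : M.det ≠ 0
  weight : WeightGE 6 (pull M F)
  cube : ∃ m ∈ (pull M F).support, m 1 = 0 ∧ m 2 = 3
  isolated : IsIsolated (dehom (pull M F))

/-- In the basis given by the columns of `M`, the vector `P` is a multiple of the first basis
vector, and the first two basis vectors span the same plane as `P` and `u`. -/
def Adapted (M : Matrix (Fin 3) (Fin 3) ℂ) (P u : Fin 3 → ℂ) : Prop :=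
  ∃ α β γ : ℂ, α ≠ 0 ∧ γ ≠ 0 ∧ P = M.mulVec ![α, 0, 0] ∧ u = M.mulVec ![β, γ, 0]

/-- `[P]` is a `[3;3]`-point of `F = 0` whose distinguished tangent is spanned by `P` and `u`. -/
def IsTriplePoint (F : MvPolynomial (Fin 3) ℂ) (P u : Fin 3 → ℂ) : Prop :=
  ∃ M, IsGerm F M ∧ Adapted M P u

/-- `F` has weight at least `2 * n` at the point `[P]` and the line spanned by `P` and `u`: the
weight is `2` for an equation of that line, and `1` for other lines through the point. -/
def VanishesAt (n : ℕ) (F : MvPolynomial (Fin 3) ℂ) (P u : Fin 3 → ℂ) : Prop :=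
  ∃ M : Matrix (Fin 3) (Fin 3) ℂ, M.det ≠ 0 ∧ WeightGE (2 * n) (pull M F) ∧ Adapted M P u

lemma IsTriplePoint.vanishesAt {F : MvPolynomial (Fin 3) ℂ} {P u : Fin 3 → ℂ}
    (h : IsTriplePoint F P u) : VanishesAt 3 F P u := by
  obtain ⟨M, hM, ha⟩ := h
  exact ⟨M, hM.det_ne_zero, hM.weight, ha⟩

lemma Adapted.of_mulVec {M B : Matrix (Fin 3) (Fin 3) ℂ} {P u : Fin 3 → ℂ} (hB : B.det ≠ 0)
    (h : Adapted M (B.mulVec P) (B.mulVec u)) : Adapted (B⁻¹ * M) P u := by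
  obtain ⟨α, β, γ, hα, hγ, hP, hu⟩ := h
  refine ⟨α, β, γ, hα, hγ, ?_, ?_⟩
  · rw [← Matrix.mulVec_mulVec, ← hP, Matrix.mulVec_mulVec,
      Matrix.nonsing_inv_mul _ (isUnit_iff_ne_zero.2 hB), Matrix.one_mulVec]
  · rw [← Matrix.mulVec_mulVec, ← hu, Matrix.mulVec_mulVec,
      Matrix.nonsing_inv_mul _ (isUnit_iff_ne_zero.2 hB), Matrix.one_mulVec]

/-- Being a `[3;3]`-point does not depend on the coordinates. -/
lemma IsTriplePoint.of_mulVec {F : MvPolynomial (Fin 3) ℂ} {B : Matrix (Fin 3) (Fin 3) ℂ}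
    {P u : Fin 3 → ℂ} (hB : B.det ≠ 0) (h : IsTriplePoint F (B.mulVec P) (B.mulVec u)) :
    IsTriplePoint (pull B F) P u := by
  obtain ⟨M, hM, ha⟩ := h
  have hpull : pull (B⁻¹ * M) (pull B F) = pull M F := by
    rw [pull_pull, ← mul_assoc, Matrix.mul_nonsing_inv _ (isUnit_iff_ne_zero.2 hB), one_mul]
  refine ⟨B⁻¹ * M, ⟨?_, ?_, ?_, ?_⟩, ha.of_mulVec hB⟩
  · rw [Matrix.det_mul, Matrix.det_nonsing_inv]
    exact mul_ne_zero (by simpa using hB) hM.det_ne_zero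
  · rw [hpull]; exact hM.weight
  · rw [hpull]; exact hM.cube
  · rw [hpull]; exact hM.isolated

lemma Adapted.change {M : Matrix (Fin 3) (Fin 3) ℂ} {P u P' u' : Fin 3 → ℂ} {a b c : ℂ}
    (h : Adapted M P u) (ha : a ≠ 0) (hc : c ≠ 0) (hP : P' = a • P) (hu : u' = b • P + c • u) :
    Adapted M P' u' := by
  obtain ⟨α, β, γ, hα, hγ, rfl, rfl⟩ := h
  refine ⟨a * α, b * α + c * β, c * γ, mul_ne_zero ha hα, mul_ne_zero hc hγ, ?_, ?_⟩
  · rw [hP, ← Matrix.mulVec_smul]; simp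
  · rw [hu, ← Matrix.mulVec_smul, ← Matrix.mulVec_smul, ← Matrix.mulVec_add]; simp

lemma IsTriplePoint.change {F : MvPolynomial (Fin 3) ℂ} {P u P' u' : Fin 3 → ℂ} {a b c : ℂ}
    (h : IsTriplePoint F P u) (ha : a ≠ 0) (hc : c ≠ 0) (hP : P' = a • P)
    (hu : u' = b • P + c • u) : IsTriplePoint F P' u' := by
  obtain ⟨M, hM, had⟩ := h
  exact ⟨M, hM, had.change ha hc hP hu⟩

lemma VanishesAt.change {n : ℕ} {F : MvPolynomial (Fin 3) ℂ} {P u P' u' : Fin 3 → ℂ} {a b c : ℂ}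
    (h : VanishesAt n F P u) (ha : a ≠ 0) (hc : c ≠ 0) (hP : P' = a • P)
    (hu : u' = b • P + c • u) : VanishesAt n F P' u' := by
  obtain ⟨M, hM, hw, had⟩ := h
  exact ⟨M, hM, hw, had.change ha hc hP hu⟩

/-! ### Restriction to parametrized curves -/

lemma aeval_cons_three (G : MvPolynomial (Fin 3) ℂ) (a b c : ℂ[X]) :
    aeval ![a, b, c] G =
      ∑ m ∈ G.support, Polynomial.C (coeff m G) * (a ^ m 0 * b ^ m 1 * c ^ m 2) := by
  rw [aeval_def, eval₂_eq']
  simp only [Fin.prod_univ_three]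
  rfl

lemma det_of_mulVec (M : Matrix (Fin 3) (Fin 3) ℂ) (x y z : Fin 3 → ℂ) :
    (Matrix.of ![M.mulVec x, M.mulVec y, M.mulVec z]).det =
      (Matrix.of ![x, y, z]).det * M.det := by
  rw [← Matrix.det_transpose M, ← Matrix.det_mul]
  congr 1
  ext i j
  fin_cases i <;> simp [Matrix.mul_apply, Matrix.mulVec, dotProduct, mul_comm]

lemma Adapted.exists_aeval_eq {M : Matrix (Fin 3) (Fin 3) ℂ} {P u : Fin 3 → ℂ} (hM : M.det ≠ 0)
    (h : Adapted M P u) : ∃ α β γ : ℂ, α ≠ 0 ∧ γ ≠ 0 ∧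
      ∀ (F : MvPolynomial (Fin 3) ℂ) (g c : Fin 3 → ℂ[X]) (a b : ℂ[X]),
        (∀ i, g i = a * Polynomial.C (P i) + b * Polynomial.C (u i) + c i) →
        aeval g F = aeval ![Polynomial.C α * a + Polynomial.C β * b +
            ((M⁻¹).map Polynomial.C).mulVec c 0,
          Polynomial.C γ * b + ((M⁻¹).map Polynomial.C).mulVec c 1,
          ((M⁻¹).map Polynomial.C).mulVec c 2] (pull M F) := by
  obtain ⟨α, β, γ, hα, hγ, hP, hu⟩ := h
  refine ⟨α, β, γ, hα, hγ, fun F g c a b hg => ?_⟩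
  have hc : c = (M.map Polynomial.C).mulVec (((M⁻¹).map Polynomial.C).mulVec c) := by
    rw [Matrix.mulVec_mulVec, ← Matrix.map_mul,
      Matrix.mul_nonsing_inv _ (isUnit_iff_ne_zero.2 hM), Matrix.map_one _ (by simp) (by simp),
      Matrix.one_mulVec]
  rw [aeval_pull]
  congr 2
  funext i
  rw [hg, hP, hu]
  conv_lhs => rw [hc]
  generalize ((M⁻¹).map Polynomial.C).mulVec c = c'
  have : (algebraMap ℂ ℂ[X]) = Polynomial.C := rfl
  simp only [this, Matrix.mulVec, dotProduct, Fin.sum_univ_three, Matrix.map_apply,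
    Matrix.cons_val, map_add, map_mul, mul_zero, add_zero]
  ring

lemma dvd_mulVec {R S : Type*} [CommRing R] [CommRing S] (N : Matrix (Fin 3) (Fin 3) R)
    (f : R → S) {y : S} {c : Fin 3 → S} (hc : ∀ i, y ∣ c i) (j : Fin 3) :
    y ∣ (N.map f).mulVec c j := by
  rw [Matrix.mulVec, dotProduct]
  exact Finset.dvd_sum fun i _ => (hc i).mul_left _

/-- The restriction of a form to a curve which passes through a point in a given direction vanishes
to an order governed by the weight of the form.  With `x = (t - t₀)` and `y = (t - t₀) ^ 2` this
applies to a smooth branch in the given direction, and with `y = x = t - t₀` to a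
transverse branch. -/
lemma VanishesAt.pow_dvd {n : ℕ} {F : MvPolynomial (Fin 3) ℂ} {P u : Fin 3 → ℂ}
    (h : VanishesAt n F P u) {g c : Fin 3 → ℂ[X]} {a b x y : ℂ[X]}
    (hg : ∀ i, g i = a * Polynomial.C (P i) + b * Polynomial.C (u i) + c i)
    (hb : x ∣ b) (hc : ∀ i, y ∣ c i) (hxy : x ∣ y) (hyx : y ∣ x ^ 2) :
    y ^ n ∣ aeval g F := by
  obtain ⟨M, hM, hw, had⟩ := h
  obtain ⟨α, β, γ, -, -, heq⟩ := had.exists_aeval_eq hM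
  rw [heq F g c a b hg, aeval_cons_three]
  have hc' := dvd_mulVec M⁻¹ Polynomial.C hc
  refine Finset.dvd_sum fun m hm => Dvd.dvd.mul_left ?_ _
  rw [mul_assoc]
  refine Dvd.dvd.mul_left ?_ _
  have h1 : x ^ m 1 * y ^ m 2 ∣ (Polynomial.C γ * b + ((M⁻¹).map Polynomial.C).mulVec c 1) ^ m 1 *
      ((M⁻¹).map Polynomial.C).mulVec c 2 ^ m 2 :=
    mul_dvd_mul (pow_dvd_pow_of_dvd (dvd_add (hb.mul_left _) (hxy.trans (hc' 1))) _)
      (pow_dvd_pow_of_dvd (hc' 2) _)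
  refine dvd_trans ?_ h1
  have hwm := hw m hm
  rcases le_or_gt n (m 2) with hn | hn
  · exact (pow_dvd_pow _ hn).mul_left _
  · obtain ⟨k, hk⟩ := Nat.exists_eq_add_of_lt hn
    have hk' : 2 * (k + 1) ≤ m 1 := by lia
    calc y ^ n = y ^ (k + 1) * y ^ m 2 := by rw [← pow_add]; congr 1; lia
      _ ∣ x ^ m 1 * y ^ m 2 := mul_dvd_mul_right
        (((pow_dvd_pow_of_dvd hyx (k + 1)).trans
          (dvd_of_eq (pow_mul x 2 (k + 1)).symm)).trans (pow_dvd_pow x hk')) _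

lemma natDegree_mulVec_add_le (N : Matrix (Fin 3) (Fin 3) ℂ) {c : Fin 3 → ℂ[X]} {k D : ℕ}
    (hc : ∀ i, c i = 0 ∨ (c i).natDegree + k ≤ D) (j : Fin 3) :
    (N.map Polynomial.C).mulVec c j = 0 ∨
      ((N.map Polynomial.C).mulVec c j).natDegree + k ≤ D := by
  by_cases hk : k ≤ D
  · right
    have : ((N.map Polynomial.C).mulVec c j).natDegree ≤ D - k := by
      rw [Matrix.mulVec, dotProduct]
      refine Polynomial.natDegree_sum_le_of_forall_le _ _ fun i _ => ?_
      refine (Polynomial.natDegree_C_mul_le _ _).trans ?_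
      rcases hc i with h | h
      · rw [h, Polynomial.natDegree_zero]; exact Nat.zero_le _
      · lia
    lia
  · left
    have : c = 0 := funext fun i => (hc i).resolve_right fun h => hk ((Nat.le_add_left _ _).trans h)
    rw [this, Matrix.mulVec_zero, Pi.zero_apply]

/-- The analogue of `VanishesAt.pow_dvd` at the point at infinity of the parameter line: a curve
parametrized by polynomials of degree `D` passes through `[P]` for the parameter `∞`, and the degree
of the restriction drops. -/
lemma VanishesAt.natDegree_add_le {n d D k : ℕ} {F : MvPolynomial (Fin 3) ℂ} {P u : Fin 3 → ℂ}
    (h : VanishesAt n F P u) (hF : F.IsHomogeneous d) {g c : Fin 3 → ℂ[X]} {a b : ℂ[X]}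
    (hg : ∀ i, g i = a * Polynomial.C (P i) + b * Polynomial.C (u i) + c i)
    (ha : a.natDegree ≤ D) (hb : b.natDegree + 1 ≤ D)
    (hc : ∀ i, c i = 0 ∨ (c i).natDegree + k ≤ D)
    (hk1 : 1 ≤ k) (hk2 : k ≤ 2) (h0 : aeval g F ≠ 0) :
    (aeval g F).natDegree + n * k ≤ d * D := by
  obtain ⟨M, hM, hw, had⟩ := h
  obtain ⟨α, β, γ, -, -, heq⟩ := had.exists_aeval_eq hM
  have hpF := isHomogeneous_pull M hF
  rw [heq F g c a b hg] at h0 ⊢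
  rw [aeval_cons_three] at h0 ⊢
  have hc' := natDegree_mulVec_add_le M⁻¹ hc
  have hle : ∀ j, (((M⁻¹).map Polynomial.C).mulVec c j).natDegree + 1 ≤ D := by
    intro j
    rcases hc' j with h | h
    · rw [h, Polynomial.natDegree_zero]; lia
    · lia
  set A := Polynomial.C α * a + Polynomial.C β * b + ((M⁻¹).map Polynomial.C).mulVec c 0
  set B := Polynomial.C γ * b + ((M⁻¹).map Polynomial.C).mulVec c 1
  set E := ((M⁻¹).map Polynomial.C).mulVec c 2
  have hA : A.natDegree ≤ D := by
    have h1 := (Polynomial.natDegree_C_mul_le α a)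
    have h2 := (Polynomial.natDegree_C_mul_le β b)
    have h3 := hle 0
    exact Polynomial.natDegree_add_le_of_degree_le
      (Polynomial.natDegree_add_le_of_degree_le (by lia) (by lia)) (by lia)
  have hB : B.natDegree ≤ D - 1 := by
    have h2 := (Polynomial.natDegree_C_mul_le γ b)
    have h3 := hle 1
    exact Polynomial.natDegree_add_le_of_degree_le (by lia) (by lia)
  obtain ⟨D', rfl⟩ : ∃ D', D = D' + 1 := ⟨D - 1, by lia⟩
  rw [Nat.add_sub_cancel] at hB
  -- Every non-zero term of the expansion in adapted coordinates satisfies the claimed bound.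
  have hterm : ∀ m ∈ (pull M F).support, A ^ m 0 * B ^ m 1 * E ^ m 2 = 0 ∨
      (Polynomial.C (coeff m (pull M F)) * (A ^ m 0 * B ^ m 1 * E ^ m 2)).natDegree + n * k
        ≤ d * (D' + 1) := by
    intro m hm
    have hs := sum_of_mem_support hpF hm
    have hwm := hw m hm
    by_cases hm2 : E = 0 ∧ m 2 ≠ 0
    · left; rw [hm2.1, zero_pow hm2.2, mul_zero]
    right
    have hE : (E ^ m 2).natDegree + m 2 * k ≤ m 2 * (D' + 1) := by
      by_cases h2 : m 2 = 0
      · simp [h2]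
      · have h3 : E.natDegree + k ≤ D' + 1 := (hc' 2).resolve_left fun h => hm2 ⟨h, h2⟩
        have h4 : (E ^ m 2).natDegree ≤ m 2 * E.natDegree := Polynomial.natDegree_pow_le
        have h5 := Nat.mul_le_mul_left (m 2) h3
        rw [mul_add] at h5
        lia
    have h1 : (Polynomial.C (coeff m (pull M F)) * (A ^ m 0 * B ^ m 1 * E ^ m 2)).natDegree ≤
        m 0 * (D' + 1) + m 1 * D' + (E ^ m 2).natDegree :=
      (Polynomial.natDegree_C_mul_le _ _).trans <|
        Polynomial.natDegree_mul_le_of_le (Polynomial.natDegree_mul_le_of_le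
          (Polynomial.natDegree_pow_le_of_le _ hA) (Polynomial.natDegree_pow_le_of_le _ hB)) le_rfl
    rw [← hs]
    obtain rfl | rfl : k = 1 ∨ k = 2 := by lia
    · nlinarith
    · nlinarith
  by_contra! hlt
  refine h0 (Polynomial.leadingCoeff_eq_zero.1 ?_)
  rw [Polynomial.leadingCoeff, Polynomial.finsetSum_coeff]
  refine Finset.sum_eq_zero fun m hm => ?_
  rcases hterm m hm with h | h
  · rw [h, mul_zero, Polynomial.coeff_zero]
  · exact Polynomial.coeff_eq_zero_of_natDegree_lt (by lia)

/-- The restriction of the equation of a `[3;3]`-point to a branch whose contact with the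
distinguished tangent is not too high does not vanish identically: along such a branch the
monomial `y ^ 3` dominates all others. -/
lemma IsTriplePoint.aeval_ne_zero {d : ℕ} {F : MvPolynomial (Fin 3) ℂ} {P u w : Fin 3 → ℂ}
    (h : IsTriplePoint F P u) (hF : F.IsHomogeneous d) (hw : (Matrix.of ![P, u, w]).det ≠ 0)
    {g : Fin 3 → ℂ[X]} {a b c x y : ℂ[X]} {t : ℂ}
    (hg : ∀ i, g i = a * Polynomial.C (P i) + x * y * b * Polynomial.C (u i) +
      x ^ 2 * y * c * Polynomial.C (w i))
    (hx : x ≠ 0) (hy : y ≠ 0) (hyt : y.eval t = 0) (ha : a.eval t ≠ 0) (hc : c.eval t ≠ 0) :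
    aeval g F ≠ 0 := by
  obtain ⟨M, hM, had⟩ := h
  obtain ⟨α, β, γ, hα, -, heq⟩ := had.exists_aeval_eq hM.det_ne_zero
  have hw2 : (M⁻¹).mulVec w 2 ≠ 0 := by
    obtain ⟨α, β, γ, hα, hγ, rfl, rfl⟩ := had
    have hww : w = M.mulVec ((M⁻¹).mulVec w) := by
      rw [Matrix.mulVec_mulVec, Matrix.mul_nonsing_inv _ (isUnit_iff_ne_zero.2 hM.det_ne_zero),
        Matrix.one_mulVec]
    rw [hww, det_of_mulVec] at hw
    intro h0
    apply hw
    simp [Matrix.det_fin_three, h0]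
  have hpF := isHomogeneous_pull M hF
  have hmul : ∀ j, ((M⁻¹).map Polynomial.C).mulVec
      (fun i => x ^ 2 * y * c * Polynomial.C (w i)) j =
      x ^ 2 * y * c * Polynomial.C ((M⁻¹).mulVec w j) := by
    intro j
    simp only [Matrix.mulVec, dotProduct, Fin.sum_univ_three, Matrix.map_apply, map_add, map_mul]
    ring
  rw [heq F g _ a (x * y * b) hg, aeval_cons_three]
  simp only [hmul]
  set w' := (M⁻¹).mulVec w
  set A := Polynomial.C α * a + Polynomial.C β * (x * y * b) +
    x ^ 2 * y * c * Polynomial.C (w' 0)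
  -- The common factor `(x ^ 2 * y) ^ 3` is extracted; the cofactor of every monomial other than
  -- that of `y ^ 3` is still divisible by `y`.
  let R : (Fin 3 →₀ ℕ) → ℂ[X] := fun m => Polynomial.C (coeff m (pull M F)) * (A ^ m 0 *
    (Polynomial.C γ * b + x * c * Polynomial.C (w' 1)) ^ m 1 *
    (c * Polynomial.C (w' 2)) ^ m 2) * x ^ (m 1 + 2 * m 2 - 6) * y ^ (m 1 + m 2 - 3)
  have hsum : ∑ m ∈ (pull M F).support, Polynomial.C (coeff m (pull M F)) *
      (A ^ m 0 * (Polynomial.C γ * (x * y * b) + x ^ 2 * y * c * Polynomial.C (w' 1)) ^ m 1 *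
        (x ^ 2 * y * c * Polynomial.C (w' 2)) ^ m 2) =
      (x ^ 2 * y) ^ 3 * ∑ m ∈ (pull M F).support, R m := by
    rw [Finset.mul_sum]
    refine Finset.sum_congr rfl fun m hm => ?_
    have hwm := hM.weight m hm
    obtain ⟨k, hk⟩ := Nat.exists_eq_add_of_le hwm
    obtain ⟨l, hl⟩ := Nat.exists_eq_add_of_le (show 3 ≤ m 1 + m 2 by lia)
    simp only [R, hk, hl, Nat.add_sub_cancel_left]
    have e1 : Polynomial.C γ * (x * y * b) + x ^ 2 * y * c * Polynomial.C (w' 1) =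
        x * y * (Polynomial.C γ * b + x * c * Polynomial.C (w' 1)) := by ring
    have e2 : (x * y) ^ m 1 * (x ^ 2 * y) ^ m 2 = (x ^ 2 * y) ^ 3 * (x ^ k * y ^ l) := by
      calc (x * y) ^ m 1 * (x ^ 2 * y) ^ m 2
          = x ^ (m 1 + 2 * m 2) * y ^ (m 1 + m 2) := by
            rw [mul_pow, mul_pow, ← pow_mul, pow_add, pow_add]; ring
        _ = _ := by rw [hk, hl]; ring
    rw [e1, mul_pow, mul_assoc (x ^ 2 * y) c, mul_pow (x ^ 2 * y)]
    linear_combination (Polynomial.C (coeff m (pull M F)) * A ^ m 0 *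
      (Polynomial.C γ * b + x * c * Polynomial.C (w' 1)) ^ m 1 *
      (c * Polynomial.C (w' 2)) ^ m 2) * e2
  rw [hsum]
  refine mul_ne_zero (pow_ne_zero _ (mul_ne_zero (pow_ne_zero _ hx) hy)) fun h0 => ?_
  obtain ⟨m₀, hm₀, h1, h2⟩ := hM.cube
  have hev := congrArg (Polynomial.eval t) h0
  rw [Polynomial.eval_finsetSum, Polynomial.eval_zero, Finset.sum_eq_single m₀] at hev
  · simp only [R, h1, h2] at hev
    have hA : A.eval t ≠ 0 := by simp [A, hyt, hα, ha]
    have hcf := mem_support_iff.1 hm₀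
    have hw2' : w' 2 ≠ 0 := hw2
    simp [hA, hcf, hc, hw2'] at hev
  · intro m hm hne
    have hwm := hM.weight m hm
    have hlt : m 1 + m 2 - 3 ≠ 0 := by
      intro h3
      apply hne
      have hs := sum_of_mem_support hpF hm
      have hs₀ := sum_of_mem_support hpF hm₀
      ext i
      fin_cases i
      · change m 0 = m₀ 0; lia
      · change m 1 = m₀ 1; lia
      · change m 2 = m₀ 2; lia
    simp only [R, Polynomial.eval_mul, Polynomial.eval_pow, hyt, zero_pow hlt, mul_zero]
  · intro h; exact absurd hm₀ h

/-! ### Factors of the equation of a `[3;3]`-point -/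

lemma VanishesAt.of_mulVec {n : ℕ} {F : MvPolynomial (Fin 3) ℂ} {B : Matrix (Fin 3) (Fin 3) ℂ}
    {P u : Fin 3 → ℂ} (hB : B.det ≠ 0) (h : VanishesAt n F (B.mulVec P) (B.mulVec u)) :
    VanishesAt n (pull B F) P u := by
  obtain ⟨M, hM, hw, ha⟩ := h
  refine ⟨B⁻¹ * M, ?_, ?_, ha.of_mulVec hB⟩
  · rw [Matrix.det_mul, Matrix.det_nonsing_inv]
    exact mul_ne_zero (by simpa using hB) hM
  · rwa [pull_pull, ← mul_assoc, Matrix.mul_nonsing_inv _ (isUnit_iff_ne_zero.2 hB), one_mul]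

lemma weightGE_one_of_eval_eq_zero {d : ℕ} {G : MvPolynomial (Fin 3) ℂ} (hG : G.IsHomogeneous d)
    {α : ℂ} (hα : α ≠ 0) (h : eval ![α, 0, 0] G = 0) : WeightGE 1 G := by
  intro m hm
  by_contra hlt
  have h1 : m 1 = 0 := by lia
  have h2 : m 2 = 0 := by lia
  rw [eval_eq', Finset.sum_eq_single m] at h
  · have := mem_support_iff.1 hm
    simp [Fin.prod_univ_three, h1, h2, hα, this] at h
  · intro m' hm' hne
    rw [Fin.prod_univ_three]
    by_cases h1' : m' 1 = 0
    · by_cases h2' : m' 2 = 0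
      · exfalso
        apply hne
        have := sum_of_mem_support hG hm
        have := sum_of_mem_support hG hm'
        ext i
        fin_cases i
        · change m' 0 = m 0; lia
        · change m' 1 = m 1; lia
        · change m' 2 = m 2; lia
      · simp [h2']
    · simp [h1']
  · intro h'; exact absurd hm h'

lemma X_pow_dvd_aeval {n : ℕ} {G : MvPolynomial (Fin 3) ℂ}
    (h : ∀ m ∈ G.support, m 1 = 0 → n ≤ m 2) :
    (Polynomial.X : ℂ[X]) ^ n ∣ aeval ![1, 0, Polynomial.X] G := by
  rw [aeval_cons_three]
  refine Finset.dvd_sum fun m hm => Dvd.dvd.mul_left ?_ _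
  by_cases h1 : m 1 = 0
  · exact (pow_dvd_pow _ (h m hm h1)).mul_left _
  · simp [zero_pow h1]

/-- A factor of the equation of a `[3;3]`-point which vanishes at that point is tangent to the
distinguished tangent: the tangent cone of the curve is three times that line, so no branch is
transverse to it. -/
lemma IsTriplePoint.vanishesAt_of_dvd {d a : ℕ} {F A : MvPolynomial (Fin 3) ℂ} {P u : Fin 3 → ℂ}
    (h : IsTriplePoint F P u) (hF : F.IsHomogeneous d) (hA : A.IsHomogeneous a) (hAF : A ∣ F)
    (hP : eval P A = 0) : VanishesAt 1 A P u := by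
  obtain ⟨M, hM, had⟩ := h
  obtain ⟨B, rfl⟩ := hAF
  refine ⟨M, hM.det_ne_zero, ?_, had⟩
  obtain ⟨α, β, γ, hα, -, rfl, -⟩ := had
  rw [← eval_pull] at hP
  have hA1 := weightGE_one_of_eval_eq_zero (isHomogeneous_pull M hA) hα hP
  by_contra hA2
  have hw := hM.weight
  have hpF := isHomogeneous_pull M hF
  obtain ⟨m₀, hm₀, h1, h2⟩ := hM.cube
  rw [pull_mul] at hw hpF hm₀
  have hB : WeightGE 5 (pull M B) := WeightGE.of_mul (k := 1) hw hA2
  have hdA : (Polynomial.X : ℂ[X]) ^ 1 ∣ aeval ![1, 0, Polynomial.X] (pull M A) :=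
    X_pow_dvd_aeval fun m hm h0 => by have := hA1 m hm; lia
  have hdB : (Polynomial.X : ℂ[X]) ^ 3 ∣ aeval ![1, 0, Polynomial.X] (pull M B) :=
    X_pow_dvd_aeval fun m hm h0 => by have := hB m hm; lia
  have hdF := mul_dvd_mul hdA hdB
  rw [← map_mul, ← pow_add, Polynomial.X_pow_dvd_iff] at hdF
  have h3 := hdF 3 (by norm_num)
  rw [aeval_cons_three, Polynomial.finsetSum_coeff, Finset.sum_eq_single m₀] at h3
  · rw [h1, h2] at h3
    simp only [one_pow, one_mul, pow_zero, Polynomial.coeff_C_mul, Polynomial.coeff_X_pow_self,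
      mul_one] at h3
    exact mem_support_iff.1 hm₀ h3
  · intro m hm hne
    by_cases hm1 : m 1 = 0
    · have hm2 : m 2 ≠ 3 := by
        intro hm2
        apply hne
        have := sum_of_mem_support hpF hm
        have := sum_of_mem_support hpF hm₀
        ext i
        fin_cases i
        · change m 0 = m₀ 0; lia
        · change m 1 = m₀ 1; lia
        · change m 2 = m₀ 2; lia
      simp [hm1, Polynomial.coeff_X_pow, Ne.symm hm2]
    · simp [zero_pow hm1]
  · intro h'; exact absurd hm₀ h'

/-- A factor which is smooth at a `[3;3]`-point accounts for weight at most `2`. -/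
lemma IsTriplePoint.vanishesAt_of_mul {F A B : MvPolynomial (Fin 3) ℂ} {P u w : Fin 3 → ℂ}
    (h : IsTriplePoint F P u) (hAB : F = A * B)
    (hA : ¬ Polynomial.X ^ 2 ∣
      aeval (fun i => Polynomial.C (P i) + Polynomial.X * Polynomial.C (w i)) A) :
    VanishesAt 2 B P u := by
  obtain ⟨M, hM, had⟩ := h
  refine ⟨M, hM.det_ne_zero, ?_, had⟩
  have hw := hM.weight
  rw [hAB, pull_mul] at hw
  refine WeightGE.of_mul (k := 2) hw fun h3 => hA ?_
  obtain ⟨α, β, γ, -, -, heq⟩ := had.exists_aeval_eq hM.det_ne_zero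
  rw [heq A _ (fun i => Polynomial.X * Polynomial.C (w i)) 1 0 (fun i => by ring),
    aeval_cons_three]
  have hdvd := dvd_mulVec M⁻¹ Polynomial.C (y := (Polynomial.X : ℂ[X]))
    (c := fun i => Polynomial.X * Polynomial.C (w i)) (fun i => dvd_mul_right _ _)
  refine Finset.dvd_sum fun m hm => Dvd.dvd.mul_left ?_ _
  rw [mul_assoc]
  refine Dvd.dvd.mul_left ?_ _
  have := h3 m hm
  refine (pow_dvd_pow _ (show 2 ≤ m 1 + m 2 by lia)).trans ?_
  rw [pow_add]
  refine mul_dvd_mul (pow_dvd_pow_of_dvd ?_ _) (pow_dvd_pow_of_dvd (hdvd 2) _)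
  rw [mul_zero, zero_add]
  exact hdvd 1

lemma eval_dehom (G : MvPolynomial (Fin 3) ℂ) (q : Fin 2 → ℂ) :
    eval q (dehom G) = eval ![1, q 0, q 1] G := by
  rw [dehom, ← aeval_eq_eval, ← aeval_eq_eval]
  change aeval q (aeval _ G) = aeval _ G
  rw [comp_aeval_apply]
  congr 2
  funext i
  fin_cases i <;> simp

/-- The equation of a `[3;3]`-point has no multiple factor which vanishes along a curve through
that point. -/
lemma IsTriplePoint.not_sq_dvd {F H : MvPolynomial (Fin 3) ℂ} {P u : Fin 3 → ℂ}
    (h : IsTriplePoint F P u) {g : ℂ → Fin 3 → ℂ} (hg : Continuous g) (hg0 : g 0 = P)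
    (hgP : ∀ t ≠ 0, ∀ c : ℂ, g t ≠ c • P) (hgH : ∀ t (c : ℂ), eval (c • g t) H = 0) :
    ¬ H ^ 2 ∣ F := by
  rintro ⟨K, rfl⟩
  obtain ⟨M, hM, α, β, γ, hα, -, hP, -⟩ := h
  have hu := isUnit_iff_ne_zero.2 hM.det_ne_zero
  set x : ℂ → Fin 3 → ℂ := fun t => (M⁻¹).mulVec (g t) with hx
  have hMx : ∀ t, M.mulVec (x t) = g t := fun t => by
    rw [hx, Matrix.mulVec_mulVec, Matrix.mul_nonsing_inv _ hu, Matrix.one_mulVec]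
  have hxc : Continuous x := continuous_const.matrix_mulVec hg
  have hx0 : x 0 = ![α, 0, 0] := by
    rw [hx]
    simp only
    rw [hg0, hP, Matrix.mulVec_mulVec, Matrix.nonsing_inv_mul _ hu, Matrix.one_mulVec]
  have hxi : ∀ i, Continuous fun t => x t i := fun i => (continuous_apply i).comp hxc
  have hne : ∀ᶠ t in 𝓝[≠] (0 : ℂ), x t 0 ≠ 0 := by
    refine Filter.Eventually.filter_mono nhdsWithin_le_nhds ?_
    refine (hxi 0).continuousAt.eventually_ne ?_
    rw [hx0]; exact hα
  let q : ℂ → Fin 2 → ℂ := fun t => ![x t 1 / x t 0, x t 2 / x t 0]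
  have hMq : ∀ t, x t 0 ≠ 0 → M.mulVec ![1, q t 0, q t 1] = (x t 0)⁻¹ • g t := by
    intro t ht
    rw [← hMx, ← Matrix.mulVec_smul]
    congr 1
    funext i
    fin_cases i
    · simp [ht]
    · simp [q, div_eq_inv_mul]
    · simp [q, div_eq_inv_mul]
  have hq : Filter.Tendsto q (𝓝[≠] 0) (𝓝[≠] 0) := by
    refine tendsto_nhdsWithin_iff.2 ⟨?_, ?_⟩
    · refine Filter.Tendsto.mono_left ?_ nhdsWithin_le_nhds
      have hca : ∀ i, ContinuousAt (fun t => x t i / x t 0) 0 := fun i =>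
        (hxi i).continuousAt.div (hxi 0).continuousAt (by rw [hx0]; exact hα)
      rw [tendsto_pi_nhds]
      intro i
      fin_cases i
      · have := (hca 1).tendsto
        simpa [q, hx0] using this
      · have := (hca 2).tendsto
        simpa [q, hx0] using this
    · filter_upwards [hne, self_mem_nhdsWithin] with t ht ht0 hq0
      have h1 : x t 1 = 0 := by
        have := congrFun hq0 0
        simpa [q, ht] using this
      have h2 : x t 2 = 0 := by
        have := congrFun hq0 1
        simpa [q, ht] using this
      refine hgP t ht0 (x t 0 / α) ?_
      rw [← hMx t, hP, ← Matrix.mulVec_smul]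
      congr 1
      funext i
      fin_cases i
      · simp [hα]
      · simpa using h1
      · simpa using h2
  obtain ⟨t, ht, ht0⟩ := ((hq.eventually hM.isolated).and hne).exists
  apply ht
  have hH : eval (q t) (dehom (pull M H)) = 0 := by
    rw [eval_dehom, eval_pull, hMq t ht0, hgH]
  have hfac : dehom (pull M (H ^ 2 * K)) = dehom (pull M H) * (dehom (pull M H) *
      dehom (pull M K)) := by
    rw [← map_mul, ← map_mul, ← pull_mul, ← pull_mul, sq, mul_assoc]
  rw [hfac]
  refine ⟨by rw [map_mul, hH, zero_mul], fun i => ?_⟩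
  rw [pderiv_mul, pderiv_mul, map_add, map_mul, map_mul, map_mul, map_add, map_mul, map_mul, hH]
  ring

/-! ### Points and directions in the projective plane -/

lemma derivative_aeval (g : Fin 3 → ℂ[X]) (Q : MvPolynomial (Fin 3) ℂ) :
    Polynomial.derivative (aeval g Q) =
      ∑ i, aeval g (pderiv i Q) * Polynomial.derivative (g i) := by
  induction Q using MvPolynomial.induction_on with
  | C a => simp
  | add p q hp hq => simp only [map_add, hp, hq, add_mul, Finset.sum_add_distrib]
  | mul_X p j hp =>
    have h2 : ∑ i, aeval g (pderiv i (X j : MvPolynomial (Fin 3) ℂ)) *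
        Polynomial.derivative (g i) = Polynomial.derivative (g j) := by
      rw [Finset.sum_eq_single j]
      · rw [pderiv_X_self, map_one, one_mul]
      · intro i _ hij
        rw [pderiv_X_of_ne (Ne.symm hij), map_zero, zero_mul]
      · simp
    have h3 : ∀ i, aeval g (pderiv i (p * X j)) * Polynomial.derivative (g i) =
        g j * (aeval g (pderiv i p) * Polynomial.derivative (g i)) +
        aeval g p * (aeval g (pderiv i (X j : MvPolynomial (Fin 3) ℂ)) * Polynomial.derivative (g i)) := by
      intro i
      rw [pderiv_mul, map_add, map_mul, map_mul, aeval_X]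
      ring
    rw [map_mul, aeval_X, Polynomial.derivative_mul, hp]
    simp only [h3]
    rw [Finset.sum_add_distrib, ← Finset.mul_sum, ← Finset.mul_sum, h2]
    ring

lemma weightGE_two_of_X_sq_dvd {d : ℕ} {G : MvPolynomial (Fin 3) ℂ} (hG : G.IsHomogeneous d)
    {α : ℂ} (hα : α ≠ 0)
    (h : (Polynomial.X : ℂ[X]) ^ 2 ∣ aeval ![Polynomial.C α, Polynomial.X, 0] G) :
    WeightGE 2 G := by
  intro m hm
  by_contra hlt
  have h2 : m 2 = 0 := by lia
  have h3 := (Polynomial.X_pow_dvd_iff.1 h) (m 1) (by lia)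
  rw [aeval_cons_three, Polynomial.finsetSum_coeff, Finset.sum_eq_single m] at h3
  · rw [h2, pow_zero, mul_one, ← Polynomial.C_pow, Polynomial.coeff_C_mul, Polynomial.coeff_C_mul,
      Polynomial.coeff_X_pow_self, mul_one] at h3
    exact mul_ne_zero (mem_support_iff.1 hm) (pow_ne_zero _ hα) h3
  · intro m' hm' hne
    by_cases h2' : m' 2 = 0
    · have h1' : m 1 ≠ m' 1 := by
        intro h1'
        apply hne
        have := sum_of_mem_support hG hm
        have := sum_of_mem_support hG hm'
        ext i
        fin_cases i
        · change m' 0 = m 0; lia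
        · change m' 1 = m 1; lia
        · change m' 2 = m 2; lia
      rw [h2', pow_zero, mul_one, ← Polynomial.C_pow, Polynomial.coeff_C_mul,
        Polynomial.coeff_C_mul, Polynomial.coeff_X_pow, if_neg h1', mul_zero, mul_zero]
    · simp [zero_pow h2']
  · intro h'; exact absurd hm h'

/-- A `[3;3]`-point in terms of homogeneous coordinate vectors. -/
lemma IsNNPointWithTangent.exists_isTriplePoint {d : ℕ} {F : MvPolynomial (Fin 3) ℂ}
    (hF : F.IsHomogeneous d) {p : ProjPlane} {L : Submodule ℂ (Fin 3 → ℂ)}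
    (h : IsNNPointWithTangent 3 F p L) :
    ∃ u, IsTriplePoint F p.rep u ∧ ∀ (k : ℕ) (Q : MvPolynomial (Fin 3) ℂ), Q.IsHomogeneous k →
      PassesInDirection Q p L → VanishesAt 1 Q p.rep u := by
  obtain ⟨P, v, w, hli, hp, hL, hgerm⟩ := h
  let M : Matrix (Fin 3) (Fin 3) ℂ := (Matrix.of ![P, v, w]).transpose
  have hM : M.det ≠ 0 := by
    rw [Matrix.det_transpose, ← isUnit_iff_ne_zero, ← Matrix.isUnit_iff_isUnit_det,
      ← Matrix.linearIndependent_rows_iff_isUnit]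
    exact hli
  have haff : affineEquation F P v w = dehom (pull M F) := by
    rw [dehom, aeval_pull, affineEquation]
    congr 2
    funext i
    simp [Matrix.mulVec, dotProduct, Fin.sum_univ_three, M, algebraMap_eq]
  rw [haff] at hgerm
  obtain ⟨hw, hcube⟩ := newtonPolygon_of_isNNGerm_dehom (isHomogeneous_pull M hF) hgerm
  have hrep : p.rep ∈ Submodule.span ℂ {P} := by
    rw [← hp, Projectivization.submodule_eq]; exact Submodule.mem_span_singleton_self _
  obtain ⟨α, hα⟩ := Submodule.mem_span_singleton.1 hrep
  have hα0 : α ≠ 0 := by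
    rintro rfl
    exact p.rep_nonzero (by rw [← hα, zero_smul])
  have had : Adapted M p.rep v := by
    refine ⟨α, 0, 1, hα0, one_ne_zero, ?_, ?_⟩
    · rw [← hα]
      funext i
      simp [Matrix.mulVec, dotProduct, Fin.sum_univ_three, M, mul_comm]
    · funext i
      simp [Matrix.mulVec, dotProduct, Fin.sum_univ_three, M]
  refine ⟨v, ⟨M, ⟨hM, hw, hcube, hgerm.1⟩, had⟩, fun k Q hQ hpass => ⟨M, hM, ?_, had⟩⟩
  refine weightGE_two_of_X_sq_dvd (isHomogeneous_pull M hQ) hα0 ?_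
  rw [aeval_pull]
  set g := (M.map (algebraMap ℂ ℂ[X])).mulVec ![Polynomial.C α, Polynomial.X, 0] with hg
  have hgi : ∀ i, g i = Polynomial.C (p.rep i) + Polynomial.X * Polynomial.C (v i) := by
    intro i
    have hC : algebraMap ℂ ℂ[X] = Polynomial.C := rfl
    rw [← hα, hg, Pi.smul_apply, smul_eq_mul, Polynomial.C_mul, hC]
    simp only [Matrix.mulVec, dotProduct, Fin.sum_univ_three, M, Matrix.map_apply,
      Matrix.transpose_apply, Matrix.of_apply, Matrix.cons_val]
    ring
  have hev : ∀ R : MvPolynomial (Fin 3) ℂ, (aeval g R).eval 0 = eval p.rep R := by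
    intro R
    rw [← Polynomial.coe_aeval_eq_eval, comp_aeval_apply, ← aeval_eq_eval]
    congr 2
    funext i
    simp [hgi]
  rw [Polynomial.X_pow_dvd_iff]
  intro j hj
  obtain rfl | rfl : j = 0 ∨ j = 1 := by lia
  · rw [Polynomial.coeff_zero_eq_eval_zero, hev, hpass.1]
  · have h1 := Polynomial.coeff_derivative (aeval g Q) 0
    rw [Polynomial.coeff_zero_eq_eval_zero, derivative_aeval, Polynomial.eval_finsetSum] at h1
    simp only [Polynomial.eval_mul, hev, hgi] at h1
    have h2 := hpass.2 v (by rw [hL]; exact Submodule.subset_span (by simp))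
    simp only [Polynomial.derivative_add, Polynomial.derivative_C, Polynomial.derivative_mul,
      Polynomial.derivative_X, Polynomial.eval_C, zero_add, one_mul, mul_zero, add_zero, h2] at h1
    simpa using h1.symm

/-! ### Lines and conics in normal form -/

lemma exists_isHomogeneous_of_mul {k d : ℕ} {Q A : MvPolynomial (Fin 3) ℂ}
    (hQ : Q.IsHomogeneous k) (h0 : Q * A ≠ 0) (hF : (Q * A).IsHomogeneous d) :
    ∃ e, d = k + e ∧ A.IsHomogeneous e := by
  let _ := gradedAlgebra (σ := Fin 3) (R := ℂ)
  have hdec : (DirectSum.decompose (homogeneousSubmodule (Fin 3) ℂ) (Q * A) d :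
      MvPolynomial (Fin 3) ℂ) = Q * A :=
    DirectSum.decompose_of_mem_same _ hF
  by_cases hkd : k ≤ d
  · refine ⟨d - k, by lia, ?_⟩
    rw [DirectSum.coe_decompose_mul_of_left_mem_of_le _ hQ hkd] at hdec
    rw [← mul_left_cancel₀ (left_ne_zero_of_mul h0) hdec]
    exact (DirectSum.decompose (homogeneousSubmodule (Fin 3) ℂ) A (d - k)).2
  · rw [DirectSum.coe_decompose_mul_of_left_mem_of_not_le _ hQ hkd] at hdec
    exact absurd hdec.symm h0

lemma aeval_line (G : MvPolynomial (Fin 3) ℂ) :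
    aeval ![1, (Polynomial.X : ℂ[X]), 0] G =
      ∑ m ∈ G.support with m 2 = 0, Polynomial.monomial (m 1) (coeff m G) := by
  rw [aeval_cons_three, Finset.sum_filter]
  refine Finset.sum_congr rfl fun m _ => ?_
  split_ifs with h
  · rw [h, one_pow, one_mul, pow_zero, mul_one, Polynomial.C_mul_X_pow_eq_monomial]
  · rw [zero_pow h, mul_zero, mul_zero]

/-- A form which vanishes on a line is divisible by the equation of that line. -/
lemma X_two_dvd_of_aeval_eq_zero {d : ℕ} {F : MvPolynomial (Fin 3) ℂ} (hF : F.IsHomogeneous d)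
    (h : aeval ![1, (Polynomial.X : ℂ[X]), 0] F = 0) : X 2 ∣ F := by
  refine X_dvd_of_forall_mem_support fun m hm h2 => mem_support_iff.1 hm ?_
  rw [aeval_line] at h
  have h1 := congrArg (Polynomial.coeff · (m 1)) h
  simp only [Polynomial.finsetSum_coeff, Polynomial.coeff_zero] at h1
  rw [Finset.sum_eq_single m] at h1
  · rwa [Polynomial.coeff_monomial_same] at h1
  · intro m' hm' hne
    rw [Polynomial.coeff_monomial, if_neg]
    intro h1'
    apply hne
    rw [Finset.mem_filter] at hm'
    have := sum_of_mem_support hF hm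
    have := sum_of_mem_support hF hm'.1
    ext i
    fin_cases i
    · change m' 0 = m 0; lia
    · exact h1'
    · change m' 2 = m 2; lia
  · intro h'; exact absurd (Finset.mem_filter.2 ⟨hm, h2⟩) h'

/-- The smooth conic parametrized by `t ↦ (1, t, t ^ 2)`. -/
noncomputable def conic : MvPolynomial (Fin 3) ℂ := X 1 ^ 2 - X 0 * X 2

lemma isHomogeneous_conic : conic.IsHomogeneous 2 :=
  (isHomogeneous_X_pow 1 2).sub ((isHomogeneous_X ℂ 0).mul (isHomogeneous_X ℂ 2))

/-- A form which vanishes on a smooth conic is divisible by the equation of the conic: modulo that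
equation a monomial of given degree depends only on its restriction to the conic. -/
lemma conic_dvd_of_aeval_eq_zero {d : ℕ} {F : MvPolynomial (Fin 3) ℂ} (hF : F.IsHomogeneous d)
    (h : aeval ![1, (Polynomial.X : ℂ[X]), Polynomial.X ^ 2] F = 0) : conic ∣ F := by
  let N : ℕ → MvPolynomial (Fin 3) ℂ := fun e =>
    X 0 ^ (d - e % 2 - e / 2) * X 1 ^ (e % 2) * X 2 ^ (e / 2)
  have hN : ∀ m ∈ F.support, conic ∣ monomial m (coeff m F) -
      C (coeff m F) * N (m 1 + 2 * m 2) := by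
    intro m hm
    have hs := sum_of_mem_support hF hm
    have hmon : (monomial m (coeff m F) : MvPolynomial (Fin 3) ℂ) =
        C (coeff m F) * (X 0 ^ m 0 * X 1 ^ m 1 * X 2 ^ m 2) := by
      rw [monomial_eq, Finsupp.prod_fintype _ _ (by simp), Fin.prod_univ_three]
    obtain ⟨k, r, hkr, hr⟩ : ∃ k r, m 1 = 2 * k + r ∧ r < 2 :=
      ⟨m 1 / 2, m 1 % 2, by lia, by lia⟩
    have e1 : (m 1 + 2 * m 2) % 2 = r := by lia
    have e2 : (m 1 + 2 * m 2) / 2 = k + m 2 := by lia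
    have e3 : d - r - (k + m 2) = m 0 + k := by lia
    have hd : conic ∣ ((X 1 ^ 2) ^ k - (X 0 * X 2) ^ k : MvPolynomial (Fin 3) ℂ) :=
      sub_dvd_pow_sub_pow _ _ k
    have hEq : (monomial m (coeff m F) : MvPolynomial (Fin 3) ℂ) -
        C (coeff m F) * N (m 1 + 2 * m 2) = ((X 1 ^ 2) ^ k - (X 0 * X 2) ^ k) *
          (C (coeff m F) * (X 0 ^ m 0 * X 1 ^ r * X 2 ^ m 2)) := by
      rw [hmon]
      simp only [N]
      rw [e1, e2, e3, hkr]
      ring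
    rw [hEq]
    exact hd.mul_right _
  have hsum : ∑ m ∈ F.support, C (coeff m F) * N (m 1 + 2 * m 2) = 0 := by
    have hp : ∑ m ∈ F.support, Polynomial.monomial (m 1 + 2 * m 2) (coeff m F) = 0 := by
      rw [← h, aeval_cons_three]
      refine Finset.sum_congr rfl fun m _ => ?_
      rw [one_pow, one_mul, ← pow_mul, ← pow_add, Polynomial.C_mul_X_pow_eq_monomial]
    have := congrArg (fun p : ℂ[X] => p.sum fun e c => C c * N e) hp
    simp only [Polynomial.sum_zero_index] at this
    rw [← this]
    symm
    have hadd : ∀ (s : Finset (Fin 3 →₀ ℕ)),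
        (∑ m ∈ s, Polynomial.monomial (m 1 + 2 * m 2) (coeff m F)).sum (fun e c => C c * N e) =
        ∑ m ∈ s, C (coeff m F) * N (m 1 + 2 * m 2) := by
      intro s
      induction s using Finset.induction_on with
      | empty => simp
      | insert a s has ih =>
        rw [Finset.sum_insert has, Finset.sum_insert has, Polynomial.sum_add_index, ih,
          Polynomial.sum_monomial_index]
        · simp
        · simp
        · intro e a b; rw [C_add, add_mul]
    exact hadd _
  have hsub : F = ∑ m ∈ F.support, (monomial m (coeff m F) -
      C (coeff m F) * N (m 1 + 2 * m 2)) := by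
    rw [Finset.sum_sub_distrib, hsum, sub_zero]
    exact F.as_sum
  rw [hsub]
  exact Finset.dvd_sum hN

/-! ### Order of vanishing along lines and conics -/

lemma Adapted.ne_smul {M : Matrix (Fin 3) (Fin 3) ℂ} {P u : Fin 3 → ℂ} (hM : M.det ≠ 0)
    (h : Adapted M P u) (c : ℂ) : u ≠ c • P := by
  obtain ⟨α, β, γ, -, hγ, rfl, rfl⟩ := h
  intro h
  rw [← Matrix.mulVec_smul] at h
  have := Matrix.mulVec_injective_of_isUnit
    ((Matrix.isUnit_iff_isUnit_det _).2 (isUnit_iff_ne_zero.2 hM)) h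
  have h1 := congrFun this 1
  simp only [Pi.smul_apply, smul_eq_mul] at h1
  exact hγ (by simpa using h1)

lemma IsTriplePoint.ne_smul {F : MvPolynomial (Fin 3) ℂ} {P u : Fin 3 → ℂ}
    (h : IsTriplePoint F P u) (c : ℂ) : u ≠ c • P := by
  obtain ⟨M, hM, had⟩ := h
  exact had.ne_smul hM.det_ne_zero c

lemma add_mul_card_le_natDegree {p : ℂ[X]} {a b : ℕ} {S : Finset ℂ} (h0 : (0 : ℂ) ∉ S)
    (ha : Polynomial.X ^ a ∣ p) (hb : ∀ r ∈ S, (Polynomial.X - Polynomial.C r) ^ b ∣ p)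
    (hp : p ≠ 0) : a + b * S.card ≤ p.natDegree := by
  have hco : ∀ r s : ℂ, r ≠ s → IsCoprime (Polynomial.X - Polynomial.C r)
      (Polynomial.X - Polynomial.C s) := fun r s hrs =>
    Polynomial.isCoprime_X_sub_C_of_isUnit_sub (isUnit_iff_ne_zero.2 (sub_ne_zero.2 hrs))
  have hprod : ∏ r ∈ S, (Polynomial.X - Polynomial.C r) ^ b ∣ p :=
    Finset.prod_dvd_of_coprime (fun r _ s _ hrs => (hco r s hrs).pow) hb
  have hX : IsCoprime (Polynomial.X ^ a : ℂ[X]) (∏ r ∈ S, (Polynomial.X - Polynomial.C r) ^ b) := by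
    refine IsCoprime.prod_right fun r hr => IsCoprime.pow ?_
    have := hco 0 r (by rintro rfl; exact h0 hr)
    rwa [Polynomial.C_0, sub_zero] at this
  have h := Polynomial.natDegree_le_of_dvd (hX.mul_dvd ha hprod) hp
  rwa [Polynomial.Monic.natDegree_mul (Polynomial.monic_X_pow a)
    (Polynomial.monic_prod_of_monic _ _ fun r _ => (Polynomial.monic_X_sub_C r).pow b),
    Polynomial.natDegree_X_pow, Polynomial.natDegree_prod_of_monic _ _
    fun r _ => (Polynomial.monic_X_sub_C r).pow b, Finset.sum_congr rfl fun r _ => by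
      rw [(Polynomial.monic_X_sub_C r).natDegree_pow, Polynomial.natDegree_X_sub_C, mul_one],
    Finset.sum_const, smul_eq_mul, mul_comm S.card b] at h

lemma VanishesAt.X_pow_dvd_line {n : ℕ} {F : MvPolynomial (Fin 3) ℂ}
    (h : VanishesAt n F ![1, 0, 0] ![0, 1, 0]) :
    Polynomial.X ^ (2 * n) ∣ aeval ![1, (Polynomial.X : ℂ[X]), 0] F := by
  rw [pow_mul]
  refine h.pow_dvd (a := 1) (b := Polynomial.X) (c := 0) (x := Polynomial.X) ?_ dvd_rfl
    (fun i => dvd_zero _) (dvd_pow_self _ two_ne_zero) dvd_rfl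
  intro i
  fin_cases i <;> simp

lemma VanishesAt.X_pow_dvd_conic {n : ℕ} {F : MvPolynomial (Fin 3) ℂ}
    (h : VanishesAt n F ![1, 0, 0] ![0, 1, 0]) :
    Polynomial.X ^ (2 * n) ∣ aeval ![1, (Polynomial.X : ℂ[X]), Polynomial.X ^ 2] F := by
  rw [pow_mul]
  refine h.pow_dvd (a := 1) (b := Polynomial.X) (c := ![0, 0, Polynomial.X ^ 2])
    (x := Polynomial.X) ?_ dvd_rfl ?_ (dvd_pow_self _ two_ne_zero) dvd_rfl
  · intro i
    fin_cases i <;> simp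
  · intro i
    fin_cases i <;> simp

lemma VanishesAt.natDegree_conic_add_le {n d : ℕ} {F : MvPolynomial (Fin 3) ℂ}
    (h : VanishesAt n F ![0, 0, 1] ![0, 1, 0]) (hF : F.IsHomogeneous d)
    (h0 : aeval ![1, (Polynomial.X : ℂ[X]), Polynomial.X ^ 2] F ≠ 0) :
    (aeval ![1, (Polynomial.X : ℂ[X]), Polynomial.X ^ 2] F).natDegree + 2 * n ≤ 2 * d := by
  rw [mul_comm 2 n, mul_comm 2 d]
  refine h.natDegree_add_le hF (a := Polynomial.X ^ 2) (b := Polynomial.X) (c := ![1, 0, 0])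
    ?_ ?_ ?_ ?_ one_le_two le_rfl h0
  · intro i
    fin_cases i <;> simp
  · rw [Polynomial.natDegree_X_pow]
  · rw [Polynomial.natDegree_X]
  · intro i
    fin_cases i <;> simp

lemma VanishesAt.X_sub_C_pow_dvd_conic {n : ℕ} {F : MvPolynomial (Fin 3) ℂ} {r : ℂ}
    {u : Fin 3 → ℂ} (h : VanishesAt n F ![1, r, r ^ 2] u) :
    (Polynomial.X - Polynomial.C r) ^ n ∣
      aeval ![1, (Polynomial.X : ℂ[X]), Polynomial.X ^ 2] F := by
  refine h.pow_dvd (a := 1) (b := 0) (c := ![0, Polynomial.X - Polynomial.C r,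
    Polynomial.X ^ 2 - Polynomial.C r ^ 2]) (x := Polynomial.X - Polynomial.C r) ?_ (dvd_zero _)
    ?_ dvd_rfl (dvd_pow_self _ two_ne_zero)
  · intro i
    fin_cases i <;> simp
  · intro i
    fin_cases i
    · simp
    · simp
    · exact sub_dvd_pow_sub_pow _ _ _

lemma aeval_tangent_conic (P w : Fin 3 → ℂ) :
    aeval (fun i => Polynomial.C (P i) + Polynomial.X * Polynomial.C (w i)) conic =
      Polynomial.C (P 1 ^ 2 - P 0 * P 2) +
      Polynomial.C (2 * P 1 * w 1 - P 0 * w 2 - P 2 * w 0) * Polynomial.X +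
      Polynomial.C (w 1 ^ 2 - w 0 * w 2) * Polynomial.X ^ 2 := by
  simp only [conic, map_sub, map_mul, map_pow, aeval_X, map_ofNat]
  ring

lemma coeff_one_of_X_sq_dvd {a b c : ℂ} (h : (Polynomial.X : ℂ[X]) ^ 2 ∣
    Polynomial.C a + Polynomial.C b * Polynomial.X + Polynomial.C c * Polynomial.X ^ 2) :
    b = 0 := by
  have := Polynomial.X_pow_dvd_iff.1 h 1 one_lt_two
  simpa [Polynomial.coeff_C, Polynomial.coeff_X_pow] using this

lemma VanishesAt.X_sq_dvd {F : MvPolynomial (Fin 3) ℂ} {P u : Fin 3 → ℂ} (h : VanishesAt 1 F P u) :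
    (Polynomial.X : ℂ[X]) ^ 2 ∣
      aeval (fun i => Polynomial.C (P i) + Polynomial.X * Polynomial.C (u i)) F := by
  have := h.pow_dvd (g := fun i => Polynomial.C (P i) + Polynomial.X * Polynomial.C (u i))
    (a := 1) (b := Polynomial.X) (c := 0) (x := Polynomial.X) (y := Polynomial.X ^ 2)
    (fun i => by simp) dvd_rfl (fun i => dvd_zero _) (dvd_pow_self _ two_ne_zero) dvd_rfl
  rwa [pow_one] at this

lemma VanishesAt.X_sub_C_pow_dvd_conic_of_tangent {n : ℕ} {F : MvPolynomial (Fin 3) ℂ} {r : ℂ}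
    {u : Fin 3 → ℂ} (h : VanishesAt n F ![1, r, r ^ 2] u)
    (ht : VanishesAt 1 conic ![1, r, r ^ 2] u) :
    (Polynomial.X - Polynomial.C r) ^ (2 * n) ∣
      aeval ![1, (Polynomial.X : ℂ[X]), Polynomial.X ^ 2] F := by
  have hne : ∀ c : ℂ, u ≠ c • ![1, r, r ^ 2] := by
    obtain ⟨M, hM, -, had⟩ := ht
    exact had.ne_smul hM
  have h1 := ht.X_sq_dvd
  rw [aeval_tangent_conic] at h1
  have hu := coeff_one_of_X_sq_dvd h1
  simp only [Matrix.cons_val] at hu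
  have hk : u 1 - r * u 0 ≠ 0 := by
    intro hk
    refine hne (u 0) (funext fun i => ?_)
    fin_cases i
    · simp
    · simp; linear_combination hk
    · simp; linear_combination -hu + 2 * r * hk
  -- The direction of the conic at this point is `(0, 1, 2 * r)`.
  have h' : VanishesAt n F ![1, r, r ^ 2] ![0, 1, 2 * r] := by
    refine h.change (a := 1) (b := -(u 1 - r * u 0)⁻¹ * u 0) (c := (u 1 - r * u 0)⁻¹) one_ne_zero
      (inv_ne_zero hk) (one_smul _ _).symm (funext fun i => ?_)
    fin_cases i
    · simp
    · simp; field_simp; ring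
    · simp; field_simp; linear_combination hu
  rw [pow_mul]
  refine h'.pow_dvd (a := 1) (b := Polynomial.X - Polynomial.C r)
    (c := ![0, 0, (Polynomial.X - Polynomial.C r) ^ 2]) (x := Polynomial.X - Polynomial.C r)
    ?_ dvd_rfl ?_ (dvd_pow_self _ two_ne_zero) dvd_rfl
  · intro i
    fin_cases i
    · simp
    · simp
    · simp [map_ofNat]; ring
  · intro i
    fin_cases i <;> simp

lemma not_X_sq_dvd_conic {P : Fin 3 → ℂ} (hP : P ≠ 0) : ∃ w : Fin 3 → ℂ,
    ¬ Polynomial.X ^ 2 ∣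
      aeval (fun i => Polynomial.C (P i) + Polynomial.X * Polynomial.C (w i)) conic := by
  by_contra! h
  simp only [aeval_tangent_conic] at h
  have h0 := coeff_one_of_X_sq_dvd (h ![1, 0, 0])
  have h1 := coeff_one_of_X_sq_dvd (h ![0, 1, 0])
  have h2 := coeff_one_of_X_sq_dvd (h ![0, 0, 1])
  simp at h0 h1 h2
  apply hP
  funext i
  fin_cases i
  · exact h2
  · exact h1
  · exact h0

/-! ### Curves with many `[3;3]`-points on a conic -/

lemma eval_conic (x : Fin 3 → ℂ) : eval x conic = x 1 ^ 2 - x 0 * x 2 := by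
  simp [conic]

/-- A conic which touches the distinguished tangents of two `[3;3]`-points cannot pass through
too many other ones: the curve would contain the conic, which would then touch the other
distinguished tangents as well, and the curve would contain the conic twice. -/
lemma not_isTriplePoint_conic {d : ℕ} {F : MvPolynomial (Fin 3) ℂ} (hF : IsPlaneCurve d F)
    (h₁ : IsTriplePoint F ![1, 0, 0] ![0, 1, 0]) (h₂ : IsTriplePoint F ![0, 0, 1] ![0, 1, 0])
    {S : Finset ℂ} (h0 : (0 : ℂ) ∉ S) {u : ℂ → Fin 3 → ℂ}
    (hS : ∀ r ∈ S, IsTriplePoint F ![1, r, r ^ 2] (u r)) (hd : 2 * d < 12 + 3 * S.card) :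
    False := by
  have hF0 : aeval ![1, (Polynomial.X : ℂ[X]), Polynomial.X ^ 2] F = 0 := by
    by_contra hne
    have h3 := add_mul_card_le_natDegree h0 h₁.vanishesAt.X_pow_dvd_conic
      (fun r hr => (hS r hr).vanishesAt.X_sub_C_pow_dvd_conic) hne
    have h4 := h₂.vanishesAt.natDegree_conic_add_le hF.1 hne
    lia
  obtain ⟨A, rfl⟩ := conic_dvd_of_aeval_eq_zero hF.1 hF0
  obtain ⟨e, rfl, hA⟩ := exists_isHomogeneous_of_mul isHomogeneous_conic hF.2 hF.1
  have hres : ∀ {P u : Fin 3 → ℂ}, P ≠ 0 → IsTriplePoint (conic * A) P u → VanishesAt 2 A P u := by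
    intro P u hP h
    obtain ⟨w, hw⟩ := not_X_sq_dvd_conic hP
    exact h.vanishesAt_of_mul rfl hw
  have hA0 : aeval ![1, (Polynomial.X : ℂ[X]), Polynomial.X ^ 2] A = 0 := by
    by_contra hne
    have h3 := add_mul_card_le_natDegree h0
      (hres (by simp) h₁).X_pow_dvd_conic
      (fun r hr => (hres (by simp) (hS r hr)).X_sub_C_pow_dvd_conic_of_tangent
        ((hS r hr).vanishesAt_of_dvd hF.1 isHomogeneous_conic (dvd_mul_right _ _)
          (by simp [eval_conic]))) hne
    have h4 := (hres (by simp) h₂).natDegree_conic_add_le hA hne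
    lia
  obtain ⟨B, rfl⟩ := conic_dvd_of_aeval_eq_zero hA hA0
  refine h₁.not_sq_dvd (H := conic) (g := fun t => ![1, t, t ^ 2]) ?_ (by simp) ?_ ?_ ⟨B, by ring⟩
  · refine continuous_pi fun i => ?_
    fin_cases i
    · exact continuous_const
    · exact continuous_id
    · exact continuous_pow 2
  · intro t ht c h
    exact ht (by simpa using congrFun h 1)
  · intro t c
    simp [eval_conic]; ring

/-- The only conic which touches the distinguished tangents of the first and the third coordinate
point and passes through the unit point is the standard one. -/
lemma exists_eq_conic_mul_C {Q : MvPolynomial (Fin 3) ℂ} (hQ : IsPlaneCurve 2 Q)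
    (h₁ : VanishesAt 1 Q ![1, 0, 0] ![0, 1, 0]) (h₂ : VanishesAt 1 Q ![0, 0, 1] ![0, 1, 0])
    (h₃ : eval ![1, 1, 1] Q = 0) : ∃ c : ℂ, c ≠ 0 ∧ Q = conic * C c := by
  have hQ0 : aeval ![1, (Polynomial.X : ℂ[X]), Polynomial.X ^ 2] Q = 0 := by
    by_contra hne
    have h3 := add_mul_card_le_natDegree (S := {1}) (b := 1) (by simp) h₁.X_pow_dvd_conic
      (fun r hr => by
        rw [Finset.mem_singleton] at hr
        rw [pow_one, Polynomial.dvd_iff_isRoot, Polynomial.IsRoot, ← Polynomial.coe_aeval_eq_eval,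
          comp_aeval_apply, ← h₃, ← aeval_eq_eval, hr]
        congr 2
        funext i
        fin_cases i <;> simp) hne
    have h4 := h₂.natDegree_conic_add_le hQ.1 hne
    rw [Finset.card_singleton] at h3
    lia
  obtain ⟨A, rfl⟩ := conic_dvd_of_aeval_eq_zero hQ.1 hQ0
  obtain ⟨e, he, hA⟩ := exists_isHomogeneous_of_mul isHomogeneous_conic hQ.2 hQ.1
  obtain rfl : e = 0 := by lia
  obtain ⟨c, rfl⟩ : ∃ c, A = C c := by
    refine ⟨coeff 0 A, ?_⟩
    exact totalDegree_eq_zero_iff_eq_C.1 (Nat.le_zero.1 hA.totalDegree_le)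
  refine ⟨c, ?_, rfl⟩
  rintro rfl
  exact hQ.2 (by rw [C_0, mul_zero])

/-- In normal form: an octic contains a conic which passes through three of its `[3;3]`-points in the
distinguished directions. -/
lemma dvd_of_vanishesAt_conic {F Q : MvPolynomial (Fin 3) ℂ} {u : Fin 3 → ℂ}
    (hF : F.IsHomogeneous 8)
    (h₁ : IsTriplePoint F ![1, 0, 0] ![0, 1, 0]) (h₂ : IsTriplePoint F ![0, 0, 1] ![0, 1, 0])
    (h₃ : IsTriplePoint F ![1, 1, 1] u) (hQ : IsPlaneCurve 2 Q)
    (hQ₁ : VanishesAt 1 Q ![1, 0, 0] ![0, 1, 0]) (hQ₂ : VanishesAt 1 Q ![0, 0, 1] ![0, 1, 0])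
    (hQ₃ : VanishesAt 1 Q ![1, 1, 1] u) : Q ∣ F := by
  have hone : (![1, 1, 1] : Fin 3 → ℂ) = ![1, 1, 1 ^ 2] := by norm_num
  have hev : eval ![1, 1, 1] Q = 0 := by
    have h := Polynomial.X_pow_dvd_iff.1 hQ₃.X_sq_dvd 0 two_pos
    rw [Polynomial.coeff_zero_eq_eval_zero, ← Polynomial.coe_aeval_eq_eval, comp_aeval_apply] at h
    rw [← h, ← aeval_eq_eval]
    congr 2
    funext i
    simp
  obtain ⟨c, hc, rfl⟩ := exists_eq_conic_mul_C hQ hQ₁ hQ₂ hev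
  have hcon : VanishesAt 1 conic ![1, 1, 1 ^ 2] u := by
    rw [hone] at hQ₃
    obtain ⟨M, hM, hw, had⟩ := hQ₃
    refine ⟨M, hM, ?_, had⟩
    rw [pull_mul, mul_comm (pull M conic)] at hw
    have hC : pull M (C c) = C c := by rw [pull, bind₁_C_right]
    rw [hC, show 2 * 1 = 2 + 0 from rfl] at hw
    refine WeightGE.of_mul (n := 2) (k := 0) hw fun h => ?_
    have := h 0 (mem_support_iff.2 (by rwa [coeff_zero_C]))
    simp at this
  have hF0 : aeval ![1, (Polynomial.X : ℂ[X]), Polynomial.X ^ 2] F = 0 := by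
    by_contra hne
    rw [hone] at h₃
    have h3 := add_mul_card_le_natDegree (S := {1}) (b := 6) (by simp)
      h₁.vanishesAt.X_pow_dvd_conic
      (fun r hr => by
        rw [Finset.mem_singleton.1 hr]
        exact h₃.vanishesAt.X_sub_C_pow_dvd_conic_of_tangent hcon) hne
    have h4 := h₂.vanishesAt.natDegree_conic_add_le hF hne
    rw [Finset.card_singleton] at h3
    lia
  obtain ⟨A, rfl⟩ := conic_dvd_of_aeval_eq_zero hF hF0
  refine mul_dvd_mul_left _ ⟨C c⁻¹ * A, ?_⟩
  rw [← mul_assoc, ← C_mul, mul_inv_cancel₀ hc, C_1, one_mul]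

/-! ### General position of `[3;3]`-points -/

/-- The determinant of three vectors; it vanishes if the corresponding points are collinear. -/
noncomputable def det3 (a b c : Fin 3 → ℂ) : ℂ := (Matrix.of ![a, b, c]).det

lemma det3_eq (a b c : Fin 3 → ℂ) : det3 a b c =
    a 0 * b 1 * c 2 - a 0 * b 2 * c 1 - a 1 * b 0 * c 2 + a 1 * b 2 * c 0 + a 2 * b 0 * c 1 -
      a 2 * b 1 * c 0 := by
  simp [det3, Matrix.det_fin_three]

lemma det3_mulVec (M : Matrix (Fin 3) (Fin 3) ℂ) (a b c : Fin 3 → ℂ) :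
    det3 (M.mulVec a) (M.mulVec b) (M.mulVec c) = det3 a b c * M.det := det_of_mulVec M a b c

/-- The matrix with the columns `a`, `b`, `c`. -/
def frame (a b c : Fin 3 → ℂ) : Matrix (Fin 3) (Fin 3) ℂ := (Matrix.of ![a, b, c]).transpose

lemma det_frame (a b c : Fin 3 → ℂ) : (frame a b c).det = det3 a b c := by
  rw [frame, Matrix.det_transpose, det3]

lemma frame_mulVec (a b c : Fin 3 → ℂ) (x y z : ℂ) :
    (frame a b c).mulVec ![x, y, z] = x • a + y • b + z • c := by
  funext i
  simp [frame, Matrix.mulVec, dotProduct, Fin.sum_univ_three, mul_comm]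

lemma mulVec_zero_vec (M : Matrix (Fin 3) (Fin 3) ℂ) : M.mulVec ![0, 0, 0] = 0 := by
  rw [← Matrix.mulVec_zero M]
  congr 1
  funext i
  fin_cases i <;> rfl

lemma exists_coord {M : Matrix (Fin 3) (Fin 3) ℂ} (hM : M.det ≠ 0) (P : Fin 3 → ℂ) :
    ∃ x y z : ℂ, P = M.mulVec ![x, y, z] := by
  refine ⟨(M⁻¹).mulVec P 0, (M⁻¹).mulVec P 1, (M⁻¹).mulVec P 2, ?_⟩
  have : ![(M⁻¹).mulVec P 0, (M⁻¹).mulVec P 1, (M⁻¹).mulVec P 2] = (M⁻¹).mulVec P := by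
    funext i
    fin_cases i <;> rfl
  rw [this, Matrix.mulVec_mulVec, Matrix.mul_nonsing_inv _ (isUnit_iff_ne_zero.2 hM),
    Matrix.one_mulVec]

lemma exists_eq_smul_add {a b c : Fin 3 → ℂ} (h : det3 a b c ≠ 0) (P : Fin 3 → ℂ) :
    ∃ x y z : ℂ, P = x • a + y • b + z • c := by
  obtain ⟨x, y, z, hP⟩ := exists_coord (M := frame a b c) (by rwa [det_frame]) P
  exact ⟨x, y, z, by rw [hP, frame_mulVec]⟩

/-- In normal form: the distinguished tangent of one `[3;3]`-point of a curve of degree at most `8`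
does not contain another one.  Otherwise the curve contains this line, which is hence the
distinguished tangent of both points, and so the curve contains it twice. -/
lemma not_isTriplePoint_tangent {d : ℕ} (hd : d ≤ 8) {F : MvPolynomial (Fin 3) ℂ}
    (hF : IsPlaneCurve d F) {u : Fin 3 → ℂ} (h₁ : IsTriplePoint F ![1, 0, 0] ![0, 1, 0])
    (h₂ : IsTriplePoint F ![0, 1, 0] u) : False := by
  have hF0 : aeval ![1, (Polynomial.X : ℂ[X]), 0] F = 0 := by
    by_contra hne
    have h3 := Polynomial.natDegree_le_of_dvd h₁.vanishesAt.X_pow_dvd_line hne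
    have h4 := h₂.vanishesAt.natDegree_add_le (D := 1) (k := 1) (a := Polynomial.X) (b := 0)
      (c := ![1, 0, 0]) (g := ![1, (Polynomial.X : ℂ[X]), 0]) hF.1
      (fun i => by fin_cases i <;> simp) (by simp) (by simp) (fun i => by fin_cases i <;> simp)
      le_rfl one_le_two hne
    rw [Polynomial.natDegree_X_pow] at h3
    lia
  obtain ⟨A, rfl⟩ := X_two_dvd_of_aeval_eq_zero hF.1 hF0
  obtain ⟨e, rfl, hA⟩ := exists_isHomogeneous_of_mul (isHomogeneous_X ℂ 2) hF.2 hF.1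
  have hres : ∀ {P u : Fin 3 → ℂ}, IsTriplePoint (X 2 * A) P u → VanishesAt 2 A P u := by
    intro P u h
    refine h.vanishesAt_of_mul (w := ![0, 0, 1]) rfl fun hdvd => ?_
    have := Polynomial.X_pow_dvd_iff.1 hdvd 1 one_lt_two
    simp at this
  have hu2 : u 2 = 0 := by
    have h := (h₂.vanishesAt_of_dvd hF.1 (isHomogeneous_X ℂ 2) (dvd_mul_right _ _)
      (by simp)).X_sq_dvd
    have := Polynomial.X_pow_dvd_iff.1 h 1 one_lt_two
    simpa [Polynomial.coeff_C] using this
  have hu0 : u 0 ≠ 0 := by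
    intro hu0
    refine h₂.ne_smul (u 1) (funext fun i => ?_)
    fin_cases i
    · simpa using hu0
    · simp
    · simpa using hu2
  have hA2 : VanishesAt 2 A ![0, 1, 0] ![1, 0, 0] := by
    refine (hres h₂).change (a := 1) (b := -(u 0)⁻¹ * u 1) (c := (u 0)⁻¹) one_ne_zero
      (inv_ne_zero hu0) (one_smul _ _).symm (funext fun i => ?_)
    fin_cases i
    · simp [hu0]
    · simp
    · simp [hu2]
  have hA0 : aeval ![1, (Polynomial.X : ℂ[X]), 0] A = 0 := by
    by_contra hne
    have h3 := Polynomial.natDegree_le_of_dvd (hres h₁).X_pow_dvd_line hne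
    have h4 := hA2.natDegree_add_le (D := 1) (k := 2) (a := Polynomial.X) (b := 1)
      (c := 0) (g := ![1, (Polynomial.X : ℂ[X]), 0]) hA
      (fun i => by fin_cases i <;> simp) (by simp) (by simp) (fun i => Or.inl rfl)
      one_le_two le_rfl hne
    rw [Polynomial.natDegree_X_pow] at h3
    lia
  obtain ⟨B, rfl⟩ := X_two_dvd_of_aeval_eq_zero hA hA0
  refine h₁.not_sq_dvd (H := X 2) (g := fun t => ![1, t, 0]) ?_ rfl ?_ ?_ ⟨B, by ring⟩
  · refine continuous_pi fun i => ?_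
    fin_cases i
    · exact continuous_const
    · exact continuous_id
    · exact continuous_const
  · intro t ht c h
    exact ht (by simpa using congrFun h 1)
  · intro t c
    simp

/-- In normal form: three `[3;3]`-points of a curve of degree at most `8` are not collinear.
Otherwise the curve contains the line through them, which would have to be the distinguished
tangent. -/
lemma not_isTriplePoint_line {d : ℕ} (hd : d ≤ 8) {F : MvPolynomial (Fin 3) ℂ}
    (hF : IsPlaneCurve d F) {u u' : Fin 3 → ℂ} {r : ℂ} (hr : r ≠ 0)
    (h₁ : IsTriplePoint F ![1, 0, 0] ![0, 0, 1]) (h₂ : IsTriplePoint F ![0, 1, 0] u)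
    (h₃ : IsTriplePoint F ![1, r, 0] u') : False := by
  have hF0 : aeval ![1, (Polynomial.X : ℂ[X]), 0] F = 0 := by
    by_contra hne
    have hX : Polynomial.X ^ 3 ∣ aeval ![1, (Polynomial.X : ℂ[X]), 0] F :=
      h₁.vanishesAt.pow_dvd (a := 1) (b := 0) (c := ![0, Polynomial.X, 0]) (x := Polynomial.X)
        (fun i => by fin_cases i <;> simp) (dvd_zero _) (fun i => by fin_cases i <;> simp)
        dvd_rfl (dvd_pow_self _ two_ne_zero)
    have hr3 : (Polynomial.X - Polynomial.C r) ^ 3 ∣ aeval ![1, (Polynomial.X : ℂ[X]), 0] F :=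
      h₃.vanishesAt.pow_dvd (a := 1) (b := 0) (c := ![0, Polynomial.X - Polynomial.C r, 0])
        (x := Polynomial.X - Polynomial.C r)
        (fun i => by fin_cases i <;> simp) (dvd_zero _) (fun i => by fin_cases i <;> simp)
        dvd_rfl (dvd_pow_self _ two_ne_zero)
    have h3 := add_mul_card_le_natDegree (S := {r}) (b := 3) (by simpa using hr.symm) hX
      (fun s hs => by rw [Finset.mem_singleton.1 hs]; exact hr3) hne
    have h4 := h₂.vanishesAt.natDegree_add_le (D := 1) (k := 1) (a := Polynomial.X) (b := 0)
      (c := ![1, 0, 0]) (g := ![1, (Polynomial.X : ℂ[X]), 0]) hF.1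
      (fun i => by fin_cases i <;> simp) (by simp) (by simp) (fun i => by fin_cases i <;> simp)
      le_rfl one_le_two hne
    rw [Finset.card_singleton] at h3
    lia
  have h := (h₁.vanishesAt_of_dvd hF.1 (isHomogeneous_X ℂ 2)
    (X_two_dvd_of_aeval_eq_zero hF.1 hF0) (by simp)).X_sq_dvd
  have := Polynomial.X_pow_dvd_iff.1 h 1 one_lt_two
  simp at this

lemma IsTriplePoint.det3_tangent_ne_zero {d : ℕ} (hd : d ≤ 8) {F : MvPolynomial (Fin 3) ℂ}
    (hF : IsPlaneCurve d F) {P u P' u' : Fin 3 → ℂ} (h : IsTriplePoint F P u)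
    (h' : IsTriplePoint F P' u') (hPP : LinearIndependent ℂ ![P, P']) : det3 P u P' ≠ 0 := by
  intro h0
  obtain ⟨M, hM, α, β, γ, hα, hγ, rfl, rfl⟩ := h
  obtain ⟨x, y, z, rfl⟩ := exists_coord hM.det_ne_zero P'
  obtain rfl : z = 0 := by
    rw [det3_mulVec, det3_eq] at h0
    simpa [hα, hγ, hM.det_ne_zero] using h0
  have hy : y ≠ 0 := by
    rintro rfl
    have := (LinearIndependent.pair_iff.1 hPP) x (-α) (by
      rw [← Matrix.mulVec_smul, ← Matrix.mulVec_smul, ← Matrix.mulVec_add]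
      simp [mul_comm, mulVec_zero_vec])
    exact hα (neg_eq_zero.1 this.2)
  set B := frame (M.mulVec ![1, 0, 0]) (M.mulVec ![x, y, 0]) (M.mulVec ![0, 0, 1]) with hBdef
  have hB : B.det ≠ 0 := by
    rw [hBdef, det_frame, det3_mulVec, det3_eq]
    simpa [hM.det_ne_zero] using hy
  have e0 : B.mulVec ![1, 0, 0] = M.mulVec ![1, 0, 0] := by rw [hBdef, frame_mulVec]; simp
  have e1 : B.mulVec ![0, 1, 0] = M.mulVec ![x, y, 0] := by rw [hBdef, frame_mulVec]; simp
  obtain ⟨a, b, c, rfl⟩ := exists_coord hB u'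
  refine not_isTriplePoint_tangent hd (isPlaneCurve_pull hB hF) (u := ![a, b, c])
    (IsTriplePoint.of_mulVec hB ⟨M, hM, 1, x, y, one_ne_zero, hy, e0, e1⟩)
    (IsTriplePoint.of_mulVec hB (by rwa [e1]))

lemma IsTriplePoint.det3_ne_zero {d : ℕ} (hd : d ≤ 8) {F : MvPolynomial (Fin 3) ℂ}
    (hF : IsPlaneCurve d F) {P₁ u₁ P₂ u₂ P₃ u₃ : Fin 3 → ℂ} (h₁ : IsTriplePoint F P₁ u₁)
    (h₂ : IsTriplePoint F P₂ u₂) (h₃ : IsTriplePoint F P₃ u₃)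
    (h₁₂ : LinearIndependent ℂ ![P₁, P₂]) (h₁₃ : LinearIndependent ℂ ![P₁, P₃])
    (h₂₃ : LinearIndependent ℂ ![P₂, P₃]) : det3 P₁ P₂ P₃ ≠ 0 := by
  intro h0
  have hB : (frame P₁ P₂ u₁).det ≠ 0 := by
    have := h₁.det3_tangent_ne_zero hd hF h₂ h₁₂
    rw [det3_eq] at this
    rw [det_frame, det3_eq]
    intro h
    exact this (by linear_combination -h)
  have e0 : (frame P₁ P₂ u₁).mulVec ![1, 0, 0] = P₁ := by rw [frame_mulVec]; simp
  have e1 : (frame P₁ P₂ u₁).mulVec ![0, 1, 0] = P₂ := by rw [frame_mulVec]; simp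
  have e2 : (frame P₁ P₂ u₁).mulVec ![0, 0, 1] = u₁ := by rw [frame_mulVec]; simp
  obtain ⟨x, y, z, hP₃⟩ := exists_coord hB P₃
  obtain rfl : z = 0 := by
    have : det3 P₁ P₂ P₃ = z * det3 P₁ P₂ u₁ := by
      rw [hP₃, frame_mulVec]
      simp only [det3_eq, Pi.add_apply, Pi.smul_apply, smul_eq_mul]
      ring
    rw [h0, ← det_frame] at this
    exact (mul_eq_zero.1 this.symm).resolve_right hB
  have hx : x ≠ 0 := by
    rintro rfl
    have := (LinearIndependent.pair_iff.1 h₂₃) y (-1) (by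
      rw [hP₃, frame_mulVec]; simp)
    exact one_ne_zero (neg_eq_zero.1 this.2)
  have hy : y ≠ 0 := by
    rintro rfl
    have := (LinearIndependent.pair_iff.1 h₁₃) x (-1) (by
      rw [hP₃, frame_mulVec]; simp)
    exact one_ne_zero (neg_eq_zero.1 this.2)
  obtain ⟨a, b, c, rfl⟩ := exists_coord hB u₂
  obtain ⟨a', b', c', rfl⟩ := exists_coord hB u₃
  refine not_isTriplePoint_line hd (isPlaneCurve_pull hB hF) (u := ![a, b, c])
    (u' := ![a', b', c']) (r := y / x) (div_ne_zero hy hx)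
    (IsTriplePoint.of_mulVec hB (by rwa [e0, e2])) (IsTriplePoint.of_mulVec hB (by rwa [e1]))
    (IsTriplePoint.of_mulVec hB ?_)
  refine h₃.change (a := x⁻¹) (b := 0) (c := 1) (inv_ne_zero hx) one_ne_zero ?_ (by simp)
  rw [hP₃, ← Matrix.mulVec_smul]
  congr 1
  funext i
  fin_cases i
  · simp [hx]
  · simp [div_eq_inv_mul]
  · simp

/-- Three `[3;3]`-points of a curve of degree at most `8` and two of their distinguished tangents
can be put into a normal form: the points are the first and the third coordinate point and the
unit point, and the two tangents meet in the second coordinate point. -/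
lemma exists_normalForm {d : ℕ} (hd : d ≤ 8) {F : MvPolynomial (Fin 3) ℂ}
    (hF : IsPlaneCurve d F) {P₁ u₁ P₂ u₂ P₃ u₃ : Fin 3 → ℂ} (h₁ : IsTriplePoint F P₁ u₁)
    (h₂ : IsTriplePoint F P₂ u₂) (h₃ : IsTriplePoint F P₃ u₃)
    (h₁₂ : LinearIndependent ℂ ![P₁, P₂]) (h₁₃ : LinearIndependent ℂ ![P₁, P₃])
    (h₂₃ : LinearIndependent ℂ ![P₂, P₃]) :
    ∃ B : Matrix (Fin 3) (Fin 3) ℂ, B.det ≠ 0 ∧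
      (∃ a b c : ℂ, a ≠ 0 ∧ c ≠ 0 ∧ B.mulVec ![1, 0, 0] = a • P₁ ∧
        B.mulVec ![0, 1, 0] = b • P₁ + c • u₁) ∧
      (∃ a b c : ℂ, a ≠ 0 ∧ c ≠ 0 ∧ B.mulVec ![0, 0, 1] = a • P₂ ∧
        B.mulVec ![0, 1, 0] = b • P₂ + c • u₂) ∧
      B.mulVec ![1, 1, 1] = P₃ := by
  have hdet := h₁.det3_ne_zero hd hF h₂ h₃ h₁₂ h₁₃ h₂₃
  have hsymm : LinearIndependent ℂ ![P₂, P₁] := LinearIndependent.pair_symm_iff.1 h₁₂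
  have t₁₂ := h₁.det3_tangent_ne_zero hd hF h₂ h₁₂
  have t₁₃ := h₁.det3_tangent_ne_zero hd hF h₃ h₁₃
  have t₂₁ := h₂.det3_tangent_ne_zero hd hF h₁ hsymm
  have t₂₃ := h₂.det3_tangent_ne_zero hd hF h₃ h₂₃
  obtain ⟨a₀, a₁, a₂, rfl⟩ := exists_eq_smul_add hdet u₁
  obtain ⟨b₀, b₁, b₂, rfl⟩ := exists_eq_smul_add hdet u₂
  have d₁₂ : det3 P₁ (a₀ • P₁ + a₁ • P₂ + a₂ • P₃) P₂ = -a₂ * det3 P₁ P₂ P₃ := by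
    simp only [det3_eq, Pi.add_apply, Pi.smul_apply, smul_eq_mul]; ring
  have d₁₃ : det3 P₁ (a₀ • P₁ + a₁ • P₂ + a₂ • P₃) P₃ = a₁ * det3 P₁ P₂ P₃ := by
    simp only [det3_eq, Pi.add_apply, Pi.smul_apply, smul_eq_mul]; ring
  have d₂₁ : det3 P₂ (b₀ • P₁ + b₁ • P₂ + b₂ • P₃) P₁ = b₂ * det3 P₁ P₂ P₃ := by
    simp only [det3_eq, Pi.add_apply, Pi.smul_apply, smul_eq_mul]; ring
  have d₂₃ : det3 P₂ (b₀ • P₁ + b₁ • P₂ + b₂ • P₃) P₃ = -b₀ * det3 P₁ P₂ P₃ := by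
    simp only [det3_eq, Pi.add_apply, Pi.smul_apply, smul_eq_mul]; ring
  rw [d₁₂] at t₁₂
  rw [d₁₃] at t₁₃
  rw [d₂₁] at t₂₁
  rw [d₂₃] at t₂₃
  have ha₂ : a₂ ≠ 0 := fun h => t₁₂ (by rw [h]; ring)
  have ha₁ : a₁ ≠ 0 := fun h => t₁₃ (by rw [h]; ring)
  have hb₂ : b₂ ≠ 0 := fun h => t₂₁ (by rw [h]; ring)
  have hb₀ : b₀ ≠ 0 := fun h => t₂₃ (by rw [h]; ring)
  -- The middle column is the point of intersection of the two tangents.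
  refine ⟨frame (-(b₀ / b₂) • P₁) ((b₀ / b₂) • P₁ + (a₁ / a₂) • P₂ + P₃) (-(a₁ / a₂) • P₂),
    ?_, ⟨-(b₀ / b₂), b₀ / b₂ - a₀ / a₂, a₂⁻¹, ?_, inv_ne_zero ha₂, ?_, ?_⟩,
    ⟨-(a₁ / a₂), a₁ / a₂ - b₁ / b₂, b₂⁻¹, ?_, inv_ne_zero hb₂, ?_, ?_⟩, ?_⟩
  · have : det3 (-(b₀ / b₂) • P₁) ((b₀ / b₂) • P₁ + (a₁ / a₂) • P₂ + P₃) (-(a₁ / a₂) • P₂) =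
        -((b₀ / b₂) * (a₁ / a₂)) * det3 P₁ P₂ P₃ := by
      simp only [det3_eq, Pi.add_apply, Pi.smul_apply, smul_eq_mul]; ring
    rw [det_frame, this]
    exact mul_ne_zero (neg_ne_zero.2 (mul_ne_zero (div_ne_zero hb₀ hb₂) (div_ne_zero ha₁ ha₂))) hdet
  · exact neg_ne_zero.2 (div_ne_zero hb₀ hb₂)
  · rw [frame_mulVec]; simp
  · rw [frame_mulVec]
    funext i
    simp only [Pi.add_apply, Pi.smul_apply, smul_eq_mul]
    field_simp
    ring
  · exact neg_ne_zero.2 (div_ne_zero ha₁ ha₂)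
  · rw [frame_mulVec]; simp
  · rw [frame_mulVec]
    funext i
    simp only [Pi.add_apply, Pi.smul_apply, smul_eq_mul]
    field_simp
    ring
  · rw [frame_mulVec]
    funext i
    simp only [Pi.add_apply, Pi.smul_apply, smul_eq_mul]
    ring

/-- A curve of degree at most `7` does not have three `[3;3]`-points. -/
lemma not_three_isTriplePoint {d : ℕ} (hd : d ≤ 7) {F : MvPolynomial (Fin 3) ℂ}
    (hF : IsPlaneCurve d F) {P₁ u₁ P₂ u₂ P₃ u₃ : Fin 3 → ℂ} (h₁ : IsTriplePoint F P₁ u₁)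
    (h₂ : IsTriplePoint F P₂ u₂) (h₃ : IsTriplePoint F P₃ u₃)
    (h₁₂ : LinearIndependent ℂ ![P₁, P₂]) (h₁₃ : LinearIndependent ℂ ![P₁, P₃])
    (h₂₃ : LinearIndependent ℂ ![P₂, P₃]) : False := by
  obtain ⟨B, hB, ⟨a, b, c, ha, hc, e0, e1⟩, ⟨a', b', c', ha', hc', e2, e1'⟩, e3⟩ :=
    exists_normalForm (by lia) hF h₁ h₂ h₃ h₁₂ h₁₃ h₂₃
  obtain ⟨x, y, z, rfl⟩ := exists_coord hB u₃
  refine not_isTriplePoint_conic (isPlaneCurve_pull hB hF)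
    (IsTriplePoint.of_mulVec hB (h₁.change ha hc e0 e1))
    (IsTriplePoint.of_mulVec hB (h₂.change ha' hc' e2 e1')) (S := {1}) (by simp)
    (u := fun _ => ![x, y, z]) (fun r hr => IsTriplePoint.of_mulVec hB ?_) (by simp; lia)
  rw [Finset.mem_singleton.1 hr, one_pow, e3]
  exact h₃

/-- An octic contains every conic which passes through three of its `[3;3]`-points in the
distinguished directions. -/
lemma dvd_of_vanishesAt {F Q : MvPolynomial (Fin 3) ℂ} (hF : IsPlaneCurve 8 F)
    (hQ : IsPlaneCurve 2 Q) {P₁ u₁ P₂ u₂ P₃ u₃ : Fin 3 → ℂ} (h₁ : IsTriplePoint F P₁ u₁)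
    (h₂ : IsTriplePoint F P₂ u₂) (h₃ : IsTriplePoint F P₃ u₃)
    (h₁₂ : LinearIndependent ℂ ![P₁, P₂]) (h₁₃ : LinearIndependent ℂ ![P₁, P₃])
    (h₂₃ : LinearIndependent ℂ ![P₂, P₃]) (hQ₁ : VanishesAt 1 Q P₁ u₁)
    (hQ₂ : VanishesAt 1 Q P₂ u₂) (hQ₃ : VanishesAt 1 Q P₃ u₃) : Q ∣ F := by
  obtain ⟨B, hB, ⟨a, b, c, ha, hc, e0, e1⟩, ⟨a', b', c', ha', hc', e2, e1'⟩, e3⟩ :=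
    exists_normalForm le_rfl hF h₁ h₂ h₃ h₁₂ h₁₃ h₂₃
  obtain ⟨x, y, z, rfl⟩ := exists_coord hB u₃
  rw [← pull_dvd_pull_iff hB]
  exact dvd_of_vanishesAt_conic (u := ![x, y, z]) (isHomogeneous_pull B hF.1)
    (IsTriplePoint.of_mulVec hB (h₁.change ha hc e0 e1))
    (IsTriplePoint.of_mulVec hB (h₂.change ha' hc' e2 e1'))
    (IsTriplePoint.of_mulVec hB (by rwa [e3])) (isPlaneCurve_pull hB hQ)
    (VanishesAt.of_mulVec hB (hQ₁.change ha hc e0 e1))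
    (VanishesAt.of_mulVec hB (hQ₂.change ha' hc' e2 e1'))
    (VanishesAt.of_mulVec hB (by rwa [e3]))

/-- No conic passes through four `[3;3]`-points of an octic and touches two of the distinguished
tangents. -/
lemma not_conic_of_four_isTriplePoint {F Q : MvPolynomial (Fin 3) ℂ} (hF : IsPlaneCurve 8 F)
    (hQ : IsPlaneCurve 2 Q) {P₁ u₁ P₂ u₂ P₃ u₃ P₄ u₄ : Fin 3 → ℂ} (h₁ : IsTriplePoint F P₁ u₁)
    (h₂ : IsTriplePoint F P₂ u₂) (h₃ : IsTriplePoint F P₃ u₃) (h₄ : IsTriplePoint F P₄ u₄)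
    (h₁₂ : LinearIndependent ℂ ![P₁, P₂]) (h₁₃ : LinearIndependent ℂ ![P₁, P₃])
    (h₂₃ : LinearIndependent ℂ ![P₂, P₃]) (h₁₄ : LinearIndependent ℂ ![P₁, P₄])
    (h₂₄ : LinearIndependent ℂ ![P₂, P₄]) (h₃₄ : LinearIndependent ℂ ![P₃, P₄])
    (hQ₁ : VanishesAt 1 Q P₁ u₁) (hQ₂ : VanishesAt 1 Q P₂ u₂) (hQ₃ : eval P₃ Q = 0)
    (hQ₄ : eval P₄ Q = 0) : False := by
  obtain ⟨B, hB, ⟨a, b, c, ha, hc, e0, e1⟩, ⟨a', b', c', ha', hc', e2, e1'⟩, e3⟩ :=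
    exists_normalForm le_rfl hF h₁ h₂ h₃ h₁₂ h₁₃ h₂₃
  obtain ⟨c₀, hc₀, hQc⟩ := exists_eq_conic_mul_C (isPlaneCurve_pull hB hQ)
    (VanishesAt.of_mulVec hB (hQ₁.change ha hc e0 e1))
    (VanishesAt.of_mulVec hB (hQ₂.change ha' hc' e2 e1')) (by rwa [eval_pull, e3])
  obtain ⟨x, y, z, rfl⟩ := exists_coord hB P₄
  obtain ⟨x₃, y₃, z₃, rfl⟩ := exists_coord hB u₃
  obtain ⟨x₄, y₄, z₄, rfl⟩ := exists_coord hB u₄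
  have hconic : y ^ 2 = x * z := by
    rw [← eval_pull, hQc, map_mul, eval_conic, eval_C] at hQ₄
    have := (mul_eq_zero.1 hQ₄).resolve_right hc₀
    simp only [Matrix.cons_val] at this
    linear_combination this
  have hx : x ≠ 0 := by
    rintro rfl
    obtain rfl : y = 0 := by simpa using hconic
    have := (LinearIndependent.pair_iff.1 h₂₄) (a' * z) (-1) (by
      rw [mul_comm, ← smul_smul, ← e2, ← Matrix.mulVec_smul, ← Matrix.mulVec_smul,
        ← Matrix.mulVec_add]
      simp [mulVec_zero_vec])
    exact one_ne_zero (neg_eq_zero.1 this.2)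
  have hP₄ : ![1, y / x, (y / x) ^ 2] = x⁻¹ • ![x, y, z] := by
    funext i
    fin_cases i
    · simp [hx]
    · simp [div_eq_inv_mul]
    · simp; field_simp; linear_combination hconic
  have hr0 : y / x ≠ 0 := by
    intro h0
    obtain rfl : y = 0 := by simpa [hx] using h0
    obtain rfl : z = 0 := by simpa [hx] using hconic
    have := (LinearIndependent.pair_iff.1 h₁₄) (a * x) (-1) (by
      rw [mul_comm, ← smul_smul, ← e0, ← Matrix.mulVec_smul, ← Matrix.mulVec_smul,
        ← Matrix.mulVec_add]
      simp [mulVec_zero_vec])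
    exact one_ne_zero (neg_eq_zero.1 this.2)
  have hr1 : y / x ≠ 1 := by
    intro h1
    rw [h1] at hP₄
    have := (LinearIndependent.pair_iff.1 h₃₄) 1 (-x⁻¹) (by
      rw [← e3, ← Matrix.mulVec_smul, ← Matrix.mulVec_smul, neg_smul, ← hP₄,
        ← Matrix.mulVec_add]
      simp [mulVec_zero_vec])
    exact one_ne_zero this.1
  have h₄' : IsTriplePoint (pull B F) ![1, y / x, (y / x) ^ 2] ![x₄, y₄, z₄] := by
    refine IsTriplePoint.of_mulVec hB (h₄.change (a := x⁻¹) (b := 0) (c := 1) (inv_ne_zero hx)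
      one_ne_zero ?_ (by simp))
    rw [hP₄, Matrix.mulVec_smul]
  classical
  refine not_isTriplePoint_conic (isPlaneCurve_pull hB hF)
    (IsTriplePoint.of_mulVec hB (h₁.change ha hc e0 e1))
    (IsTriplePoint.of_mulVec hB (h₂.change ha' hc' e2 e1')) (S := {1, y / x})
    (by simpa using hr0.symm)
    (u := fun r => if r = 1 then ![x₃, y₃, z₃] else ![x₄, y₄, z₄]) (fun r hr => ?_)
    (by rw [Finset.card_pair hr1.symm]; lia)
  rw [Finset.mem_insert, Finset.mem_singleton] at hr
  rcases hr with rfl | rfl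
  · rw [if_pos rfl, one_pow]
    exact IsTriplePoint.of_mulVec hB (by rwa [e3])
  · rw [if_neg hr1]
    exact h₄'

/-! ### Four `[3;3]`-points in normal form -/

/-- The form of `not_conic_of_four_isTriplePoint` for an indexed family of points. -/
lemma not_conic_of_isTriplePoint {F Q : MvPolynomial (Fin 3) ℂ} (hF : IsPlaneCurve 8 F)
    (hQ : IsPlaneCurve 2 Q) {P u : Fin 4 → Fin 3 → ℂ} (h : ∀ i, IsTriplePoint F (P i) (u i))
    (hP : ∀ i j, i ≠ j → LinearIndependent ℂ ![P i, P j]) {i j : Fin 4} (hij : i ≠ j)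
    (hi : VanishesAt 1 Q (P i) (u i)) (hj : VanishesAt 1 Q (P j) (u j))
    (hQP : ∀ k, eval (P k) Q = 0) : False := by
  have hkl : ∀ i j : Fin 4, i ≠ j →
      ∃ k l, i ≠ k ∧ j ≠ k ∧ i ≠ l ∧ j ≠ l ∧ k ≠ l := by decide
  obtain ⟨k, l, hik, hjk, hil, hjl, hkl⟩ := hkl i j hij
  exact not_conic_of_four_isTriplePoint hF hQ (h i) (h j) (h k) (h l) (hP i j hij) (hP i k hik)
    (hP j k hjk) (hP i l hil) (hP j l hjl) (hP k l hkl) hi hj (hQP k) (hQP l)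

lemma vanishesAt_one_of_X_sq_dvd {d : ℕ} {Q : MvPolynomial (Fin 3) ℂ} (hQ : Q.IsHomogeneous d)
    {P u w : Fin 3 → ℂ} (hw : det3 P u w ≠ 0)
    (h : (Polynomial.X : ℂ[X]) ^ 2 ∣
      aeval (fun i => Polynomial.C (P i) + Polynomial.X * Polynomial.C (u i)) Q) :
    VanishesAt 1 Q P u := by
  refine ⟨frame P u w, by rwa [det_frame], ?_, 1, 0, 1, one_ne_zero, one_ne_zero,
    by rw [frame_mulVec]; simp, by rw [frame_mulVec]; simp⟩
  refine weightGE_two_of_X_sq_dvd (isHomogeneous_pull _ hQ) (α := 1) one_ne_zero ?_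
  rw [aeval_pull]
  have hg : ((frame P u w).map (algebraMap ℂ ℂ[X])).mulVec ![Polynomial.C 1, Polynomial.X, 0] =
      fun i => Polynomial.C (P i) + Polynomial.X * Polynomial.C (u i) := by
    funext i
    simp only [frame, Matrix.mulVec, dotProduct, Fin.sum_univ_three, Matrix.map_apply,
      Matrix.transpose_apply, Matrix.of_apply, Matrix.cons_val, Polynomial.algebraMap_eq, map_one]
    ring
  rwa [hg]

/-- The image of the line with coefficients `l` under the standard quadratic transformation: a conic
through the three coordinate points. -/
noncomputable def vertexConic (l : Fin 3 → ℂ) : MvPolynomial (Fin 3) ℂ :=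
  C (l 0) * (X 1 * X 2) + C (l 1) * (X 0 * X 2) + C (l 2) * (X 0 * X 1)

lemma eval_vertexConic (l x : Fin 3 → ℂ) :
    eval x (vertexConic l) = l 0 * (x 1 * x 2) + l 1 * (x 0 * x 2) + l 2 * (x 0 * x 1) := by
  simp [vertexConic]

lemma isPlaneCurve_vertexConic {l : Fin 3 → ℂ} (hl : l ≠ 0) : IsPlaneCurve 2 (vertexConic l) := by
  have hX : ∀ i j : Fin 3, (X i * X j : MvPolynomial (Fin 3) ℂ).IsHomogeneous 2 := fun i j =>
    (isHomogeneous_X ℂ i).mul (isHomogeneous_X ℂ j)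
  refine ⟨((hX 1 2).C_mul _).add ((hX 0 2).C_mul _) |>.add ((hX 0 1).C_mul _), fun h0 => hl ?_⟩
  have h (x : Fin 3 → ℂ) := eval_vertexConic l x
  rw [h0] at h
  funext i
  fin_cases i
  · simpa using (h ![0, 1, 1]).symm
  · simpa using (h ![1, 0, 1]).symm
  · simpa using (h ![1, 1, 0]).symm

lemma vanishesAt_vertexConic {l P u w : Fin 3 → ℂ} (hl : l ≠ 0) (hw : det3 P u w ≠ 0)
    (h0 : l 0 * (P 1 * P 2) + l 1 * (P 0 * P 2) + l 2 * (P 0 * P 1) = 0)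
    (h1 : l 0 * (P 1 * u 2 + P 2 * u 1) + l 1 * (P 0 * u 2 + P 2 * u 0) +
      l 2 * (P 0 * u 1 + P 1 * u 0) = 0) : VanishesAt 1 (vertexConic l) P u := by
  refine vanishesAt_one_of_X_sq_dvd (isPlaneCurve_vertexConic hl).1 hw
    ⟨Polynomial.C (l 0 * (u 1 * u 2) + l 1 * (u 0 * u 2) + l 2 * (u 0 * u 1)), ?_⟩
  have e0 := congrArg Polynomial.C h0
  have e1 := congrArg Polynomial.C h1
  simp only [map_add, map_mul, map_zero] at e0 e1
  simp only [vertexConic, map_add, map_mul, aeval_X, algHom_C, Polynomial.algebraMap_eq]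
  linear_combination e0 + Polynomial.X * e1

/-- Four points in normal form: the coordinate points and the unit point. -/
def normalPoints : Fin 4 → Fin 3 → ℂ := ![![1, 0, 0], ![0, 1, 0], ![0, 0, 1], ![1, 1, 1]]

/-- Directions at the four points in normal form. At a coordinate point, a vector is only relevant
modulo that point and up to a scalar, which leaves one parameter. -/
def normalDirections (a b c : ℂ) (u : Fin 3 → ℂ) : Fin 4 → Fin 3 → ℂ :=
  ![![0, a, 1], ![1, 0, b], ![c, 1, 0], u]

lemma linearIndependent_normalPoints (i j : Fin 4) (hij : i ≠ j) :
    LinearIndependent ℂ ![normalPoints i, normalPoints j] := by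
  rw [LinearIndependent.pair_iff]
  intro s t h
  have h0 := congrFun h 0
  have h1 := congrFun h 1
  have h2 := congrFun h 2
  fin_cases i <;> fin_cases j <;> simp_all [normalPoints]

/-- The standard quadratic transformation turns the four directions into the points `(0, 1, a)`,
`(b, 0, 1)`, `(c, 1, 0)` and a direction at the unit point.  No line through the unit point contains
two of them, since its image would be a conic which is excluded by
`not_conic_of_isTriplePoint`. -/
lemma line_normal_form {F : MvPolynomial (Fin 3) ℂ} (hF : IsPlaneCurve 8 F) {a b c : ℂ}
    {u : Fin 3 → ℂ}
    (h : ∀ i, IsTriplePoint F (normalPoints i) (normalDirections a b c u i)) {l : Fin 3 → ℂ}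
    (hl : l ≠ 0) (hsum : l 0 + l 1 + l 2 = 0) {i j : Fin 4} (hij : i ≠ j)
    (hi : (![l 1 + a * l 2, b * l 0 + l 2, l 0 + c * l 1, l 0 * u 0 + l 1 * u 1 + l 2 * u 2] :
      Fin 4 → ℂ) i = 0)
    (hj : (![l 1 + a * l 2, b * l 0 + l 2, l 0 + c * l 1, l 0 * u 0 + l 1 * u 1 + l 2 * u 2] :
      Fin 4 → ℂ) j = 0) : False := by
  have hV : ∀ i, (![l 1 + a * l 2, b * l 0 + l 2, l 0 + c * l 1,
      l 0 * u 0 + l 1 * u 1 + l 2 * u 2] : Fin 4 → ℂ) i = 0 →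
      VanishesAt 1 (vertexConic l) (normalPoints i) (normalDirections a b c u i) := by
    intro i hi
    fin_cases i
    · refine vanishesAt_vertexConic (w := ![0, 1, 0]) hl
        (by simp [det3_eq, normalPoints, normalDirections]) ?_ ?_
      · simp [normalPoints]
      · simp [normalPoints, normalDirections] at hi ⊢
        linear_combination hi
    · refine vanishesAt_vertexConic (w := ![0, 0, 1]) hl
        (by simp [det3_eq, normalPoints, normalDirections]) ?_ ?_
      · simp [normalPoints]
      · simp [normalPoints, normalDirections] at hi ⊢
        linear_combination hi
    · refine vanishesAt_vertexConic (w := ![1, 0, 0]) hl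
        (by simp [det3_eq, normalPoints, normalDirections]) ?_ ?_
      · simp [normalPoints]
      · simp [normalPoints, normalDirections] at hi ⊢
        linear_combination hi
    · refine vanishesAt_vertexConic (w := normalPoints 0) hl
        ((h 3).det3_tangent_ne_zero le_rfl hF (h 0) (linearIndependent_normalPoints 3 0 (by decide)))
        ?_ ?_
      · simp [normalPoints]
        linear_combination hsum
      · simp [normalPoints, normalDirections] at hi ⊢
        linear_combination (u 0 + u 1 + u 2) * hsum - hi
  refine not_conic_of_isTriplePoint hF (isPlaneCurve_vertexConic hl) h
    linearIndependent_normalPoints hij (hV i hi) (hV j hj) fun k => ?_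
  rw [eval_vertexConic]
  fin_cases k
  · simp [normalPoints]
  · simp [normalPoints]
  · simp [normalPoints]
  · simp [normalPoints]
    linear_combination hsum

/-- A form of degree `8` which vanishes to order `3` at a coordinate point has degree at most `5`
in the corresponding variable. -/
lemma VanishesAt.degreeOf_le {F : MvPolynomial (Fin 3) ℂ} (hF : F.IsHomogeneous 8)
    {P u : Fin 3 → ℂ} (h : VanishesAt 3 F P u) {i : Fin 3} (hP : ∀ j, j ≠ i → P j = 0)
    {m : Fin 3 →₀ ℕ} (hm : m ∈ F.support) : m i ≤ 5 := by
  obtain ⟨M, hM, hw, α, β, γ, hα, -, hP', -⟩ := h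
  have hu := isUnit_iff_ne_zero.2 hM
  have hcol : ∀ k, k ≠ 0 → M⁻¹ k i = 0 := by
    intro k hk
    have h1 : M⁻¹.mulVec P = ![α, 0, 0] := by
      rw [hP', Matrix.mulVec_mulVec, Matrix.nonsing_inv_mul _ hu, Matrix.one_mulVec]
    have h2 : M⁻¹.mulVec P = fun k => M⁻¹ k i * P i := by
      funext k
      rw [Matrix.mulVec, dotProduct, Fintype.sum_eq_single i fun j hj => by rw [hP j hj, mul_zero]]
    have hPi : P i ≠ 0 := fun h0 => hα (by
      have := congrFun (h1.symm.trans h2) 0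
      simpa [h0] using this)
    have h3 := congrFun (h1.symm.trans h2) k
    have h4 : (![α, 0, 0] : Fin 3 → ℂ) k = 0 := by
      fin_cases k
      · exact absurd rfl hk
      · rfl
      · rfl
    rw [h4] at h3
    exact (mul_eq_zero.1 h3.symm).resolve_right hPi
  have hmon : ∀ (j : Fin 3) (c : ℂ), degreeOf i (monomial (Finsupp.single j 1) c :
      MvPolynomial (Fin 3) ℂ) ≤ if j = i ∧ c ≠ 0 then 1 else 0 := by
    intro j c
    rcases eq_or_ne c 0 with rfl | hc
    · simp
    · rw [degreeOf_monomial_eq _ _ hc]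
      rcases eq_or_ne j i with rfl | hj
      · simp [hc]
      · simp [hj]
  have hdeg : ∀ k, (M⁻¹.toMvPolynomial k).degreeOf i ≤ if k = 0 then 1 else 0 := by
    intro k
    refine (degreeOf_sum_le _ _ _).trans (Finset.sup_le fun j _ => (hmon j _).trans ?_)
    split_ifs with h1 h2 h2
    · exact le_rfl
    · rw [h1.1] at h1
      exact absurd (hcol k h2) h1.2
    · exact Nat.zero_le _
    · exact le_rfl
  have hF' : F = ∑ n ∈ (pull M F).support, C (coeff n (pull M F)) *
      ∏ k, M⁻¹.toMvPolynomial k ^ n k := by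
    conv_lhs => rw [← pull_one F, ← Matrix.mul_nonsing_inv M hu, ← pull_pull]
    rw [pull, bind₁, aeval_def, eval₂_eq']
    rfl
  refine (monomial_le_degreeOf i hm).trans ?_
  rw [hF']
  refine (degreeOf_sum_le _ _ _).trans (Finset.sup_le fun n hn => ?_)
  have h8 := sum_of_mem_support (isHomogeneous_pull M hF) hn
  have h6 := hw n hn
  have hk : ∀ k, (M⁻¹.toMvPolynomial k ^ n k).degreeOf i ≤ n k * if k = 0 then 1 else 0 :=
    fun k => (degreeOf_pow_le _ _ _).trans (Nat.mul_le_mul_left _ (hdeg k))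
  refine (degreeOf_C_mul_le _ _ _).trans ?_
  rw [Fin.prod_univ_three]
  refine (degreeOf_mul_le _ _ _).trans ?_
  have := degreeOf_mul_le i (M⁻¹.toMvPolynomial 0 ^ n 0) (M⁻¹.toMvPolynomial 1 ^ n 1)
  have h0 := hk 0
  have h1 := hk 1
  have h2 := hk 2
  simp at h0 h1 h2
  lia

/-! ### A rational quartic -/

/-- In normal form, unless `1 + a * b * c = 0`, the unit point and the direction there can be
expressed by the points `(0, 1, a)`, `(b, 0, 1)`, `(1, c, 0)` which correspond to the other three
directions. No coefficient of the unit point vanishes and the quotients of the coefficients are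
distinct. -/
lemma exists_coefficients {F : MvPolynomial (Fin 3) ℂ} (hF : IsPlaneCurve 8 F) {a b c : ℂ}
    {u : Fin 3 → ℂ}
    (h : ∀ i, IsTriplePoint F (normalPoints i) (normalDirections a b c u i))
    (habc : 1 + a * b * c ≠ 0) :
    ∃ σ₁ σ₂ σ₃ w₁ w₂ w₃ : ℂ, σ₁ ≠ 0 ∧ σ₂ ≠ 0 ∧ σ₃ ≠ 0 ∧ w₁ ≠ w₂ ∧ w₁ ≠ w₃ ∧ w₂ ≠ w₃ ∧
      b * σ₂ + σ₃ = 1 ∧ σ₁ + c * σ₃ = 1 ∧ a * σ₁ + σ₂ = 1 ∧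
      u 0 = b * σ₂ * w₂ + σ₃ * w₃ ∧ u 1 = σ₁ * w₁ + c * σ₃ * w₃ ∧
      u 2 = a * σ₁ * w₁ + σ₂ * w₂ := by
  have hq : det3 ![0, 1, a] ![b, 0, 1] ![1, c, 0] ≠ 0 := by
    rw [det3_eq]
    simp
    convert habc using 1
  obtain ⟨σ₁, σ₂, σ₃, hσ⟩ := exists_eq_smul_add hq ![1, 1, 1]
  obtain ⟨ω₁, ω₂, ω₃, hω⟩ := exists_eq_smul_add hq u
  have e0 : 1 = b * σ₂ + σ₃ := by simpa [mul_comm] using congrFun hσ 0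
  have e1 : 1 = σ₁ + c * σ₃ := by simpa [mul_comm] using congrFun hσ 1
  have e2 : 1 = a * σ₁ + σ₂ := by simpa [mul_comm] using congrFun hσ 2
  have f0 : u 0 = b * ω₂ + ω₃ := by simpa [mul_comm] using congrFun hω 0
  have f1 : u 1 = ω₁ + c * ω₃ := by simpa [mul_comm] using congrFun hω 1
  have f2 : u 2 = a * ω₁ + ω₂ := by simpa [mul_comm] using congrFun hω 2
  clear hσ hω
  have h₁ : σ₁ ≠ 0 := by
    rintro rfl
    refine line_normal_form hF h (l := ![-c, 1, b * c])
      (fun h0 => one_ne_zero (congrFun h0 1)) ?_ (i := 1) (j := 2) (by decide) ?_ ?_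
    · simp only [Matrix.cons_val]
      linear_combination e1 - c * e0 + b * c * e2
    · simp only [Matrix.cons_val]
      ring
    · simp only [Matrix.cons_val]
      ring
  have h₂ : σ₂ ≠ 0 := by
    rintro rfl
    refine line_normal_form hF h (l := ![a * c, -a, 1])
      (fun h0 => one_ne_zero (congrFun h0 2)) ?_ (i := 0) (j := 2) (by decide) ?_ ?_
    · simp only [Matrix.cons_val]
      linear_combination a * c * e0 - a * e1 + e2
    · simp only [Matrix.cons_val]
      ring
    · simp only [Matrix.cons_val]
      ring
  have h₃ : σ₃ ≠ 0 := by
    rintro rfl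
    refine line_normal_form hF h (l := ![1, a * b, -b])
      (fun h0 => one_ne_zero (congrFun h0 0)) ?_ (i := 0) (j := 1) (by decide) ?_ ?_
    · simp only [Matrix.cons_val]
      linear_combination e0 + a * b * e1 - b * e2
    · simp only [Matrix.cons_val]
      ring
    · simp only [Matrix.cons_val]
      ring
  -- The line through the unit point in the direction there.
  have hu : ∀ w, ¬ (u 0 = w ∧ u 1 = w ∧ u 2 = w) := by
    rintro w ⟨hx, hy, hz⟩
    refine (h 3).ne_smul w (funext fun i => ?_)
    fin_cases i
    · simpa [normalDirections, normalPoints] using hx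
    · simpa [normalDirections, normalPoints] using hy
    · simpa [normalDirections, normalPoints] using hz
  have hl : (![u 2 - u 1, u 0 - u 2, u 1 - u 0] : Fin 3 → ℂ) ≠ 0 := fun h0 =>
    hu (u 0) ⟨rfl, sub_eq_zero.1 (congrFun h0 2), (sub_eq_zero.1 (congrFun h0 1)).symm⟩
  have hline := fun i (hi : i ≠ 3) h' => line_normal_form hF h hl (by simp) (j := 3) hi h'
    (by simp only [Matrix.cons_val]; ring)
  simp only [Matrix.cons_val] at hline
  refine ⟨σ₁, σ₂, σ₃, ω₁ / σ₁, ω₂ / σ₂, ω₃ / σ₃, h₁, h₂, h₃, fun hw => ?_, fun hw => ?_,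
    fun hw => ?_, e0.symm, e1.symm, e2.symm, ?_, ?_, ?_⟩
  · obtain ⟨w, rfl⟩ : ∃ w, ω₁ = w * σ₁ := ⟨ω₁ / σ₁, by field_simp⟩
    obtain rfl : ω₂ = w * σ₂ := by field_simp at hw; linear_combination -hw
    have hne : ω₃ - w * σ₃ ≠ 0 := fun h0 => hu w
      ⟨by linear_combination f0 + h0 - w * e0, by linear_combination f1 + c * h0 - w * e1,
        by linear_combination f2 - w * e2⟩
    refine hline 2 (by decide) (mul_left_cancel₀ hne ?_)
    simp only [Matrix.cons_val]
    linear_combination -(u 2 - u 1) * (f0 - w * e0) - (u 0 - u 2) * (f1 - w * e1) -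
      (u 1 - u 0) * (f2 - w * e2)
  · obtain ⟨w, rfl⟩ : ∃ w, ω₁ = w * σ₁ := ⟨ω₁ / σ₁, by field_simp⟩
    obtain rfl : ω₃ = w * σ₃ := by field_simp at hw; linear_combination -hw
    have hne : ω₂ - w * σ₂ ≠ 0 := fun h0 => hu w
      ⟨by linear_combination f0 + b * h0 - w * e0, by linear_combination f1 - w * e1,
        by linear_combination f2 + h0 - w * e2⟩
    refine hline 1 (by decide) (mul_left_cancel₀ hne ?_)
    simp only [Matrix.cons_val]
    linear_combination -(u 2 - u 1) * (f0 - w * e0) - (u 0 - u 2) * (f1 - w * e1) -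
      (u 1 - u 0) * (f2 - w * e2)
  · obtain ⟨w, rfl⟩ : ∃ w, ω₂ = w * σ₂ := ⟨ω₂ / σ₂, by field_simp⟩
    obtain rfl : ω₃ = w * σ₃ := by field_simp at hw; linear_combination -hw
    have hne : ω₁ - w * σ₁ ≠ 0 := fun h0 => hu w
      ⟨by linear_combination f0 - w * e0, by linear_combination f1 + h0 - w * e1,
        by linear_combination f2 + a * h0 - w * e2⟩
    refine hline 0 (by decide) (mul_left_cancel₀ hne ?_)
    simp only [Matrix.cons_val]
    linear_combination -(u 2 - u 1) * (f0 - w * e0) - (u 0 - u 2) * (f1 - w * e1) -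
      (u 1 - u 0) * (f2 - w * e2)
  · rw [f0]; field_simp
  · rw [f1]; field_simp
  · rw [f2]; field_simp

/-- On the image of a curve under the standard quadratic transformation, a form of degree `8` which
has multiplicity at least `3` at the coordinate points vanishes where the curve meets the
coordinate lines. -/
lemma mul_pow_dvd_aeval {F : MvPolynomial (Fin 3) ℂ} (hF : F.IsHomogeneous 8)
    (h : ∀ m ∈ F.support, ∀ i, m i ≤ 5) (x y z : ℂ[X]) :
    (x * y * z) ^ 3 ∣ aeval ![y * z, x * z, x * y] F := by
  rw [aeval_cons_three]
  refine Finset.dvd_sum fun m hm => Dvd.dvd.mul_left ?_ _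
  have h8 := sum_of_mem_support hF hm
  obtain ⟨i, hi⟩ := Nat.exists_eq_add_of_le (h m hm 0)
  obtain ⟨j, hj⟩ := Nat.exists_eq_add_of_le (h m hm 1)
  obtain ⟨k, hk⟩ := Nat.exists_eq_add_of_le (h m hm 2)
  have e : (y * z) ^ m 0 * (x * z) ^ m 1 * (x * y) ^ m 2 =
      x ^ (m 1 + m 2) * y ^ (m 0 + m 2) * z ^ (m 0 + m 1) := by
    ring
  rw [e, mul_pow, mul_pow]
  exact mul_dvd_mul (mul_dvd_mul (pow_dvd_pow _ (by lia)) (pow_dvd_pow _ (by lia)))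
    (pow_dvd_pow _ (by lia))

/-- If `1 + p * q ≠ 0`, then the two linear forms `p * s * (r - w) + t * (r - v)` and
`s * (r - w) - q * t * (r - v)` in `r` do not have a common root. -/
lemma sub_ne_zero_of_relation {p q r s t v w : ℂ} (hp : p ≠ 0) (hs : s ≠ 0) (ht : t ≠ 0)
    (hvw : v ≠ w) (hq : 1 + p * q ≠ 0) (h : p * s * (r - w) + t * (r - v) = 0) :
    r ≠ v ∧ r ≠ w ∧ s * (r - w) - q * t * (r - v) ≠ 0 := by
  have hv : r ≠ v := by
    rintro rfl
    rw [sub_self, mul_zero, add_zero] at h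
    exact mul_ne_zero (mul_ne_zero hp hs) (sub_ne_zero.2 hvw) h
  refine ⟨hv, ?_, fun h0 => ?_⟩
  · rintro rfl
    rw [sub_self, mul_zero, zero_add] at h
    exact mul_ne_zero ht (sub_ne_zero.2 hvw.symm) h
  · exact mul_ne_zero (mul_ne_zero hq ht) (sub_ne_zero.2 hv) (by linear_combination h - p * h0)

lemma X_sub_C_pow_dvd_of_mul {p q : ℂ[X]} {w : ℂ} {n : ℕ} (hp : p.eval w ≠ 0)
    (h : (Polynomial.X - Polynomial.C w) ^ n ∣ p ^ n * q) :
    (Polynomial.X - Polynomial.C w) ^ n ∣ q := by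
  refine IsCoprime.dvd_of_dvd_mul_left ?_ h
  refine IsCoprime.pow ((Polynomial.irreducible_X_sub_C w).coprime_iff_not_dvd.2 fun hd => hp ?_)
  exact Polynomial.dvd_iff_isRoot.1 hd

/-- The conic parametrized by `(L₁ * R₁, L₂ * R₂, L₃ * R₃)` passes through `(0, 1, a)`, `(b, 0, 1)`,
`(1, c, 0)` for the parameters `w₁`, `w₂`, `w₃` and through the unit point in the direction `u` for
the parameter `∞`. Its image under the standard quadratic transformation is a curve of degree `4`
which has one branch in the given direction (at `wᵢ`) and another branch (at `rᵢ`) in each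
coordinate point. The order of vanishing of `F` on it exceeds the degree. -/
lemma aeval_eq_zero_of_parametrization {F : MvPolynomial (Fin 3) ℂ} (hF : F.IsHomogeneous 8)
    {a b c : ℂ} {u : Fin 3 → ℂ}
    (h : ∀ i, VanishesAt 3 F (normalPoints i) (normalDirections a b c u i))
    (ha : a ≠ 0) (hb : b ≠ 0) (hc : c ≠ 0) {σ₁ σ₂ σ₃ w₁ w₂ w₃ r₁ r₂ r₃ : ℂ}
    (h₁ : σ₁ ≠ 0) (h₂ : σ₂ ≠ 0) (h₃ : σ₃ ≠ 0)
    (h₁₂ : w₁ ≠ w₂) (h₁₃ : w₁ ≠ w₃) (h₂₃ : w₂ ≠ w₃)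
    (e0 : b * σ₂ + σ₃ = 1) (e1 : σ₁ + c * σ₃ = 1) (e2 : a * σ₁ + σ₂ = 1)
    (f0 : u 0 = b * σ₂ * w₂ + σ₃ * w₃) (f1 : u 1 = σ₁ * w₁ + c * σ₃ * w₃)
    (f2 : u 2 = a * σ₁ * w₁ + σ₂ * w₂)
    (g0 : r₁ = b * σ₂ * w₃ + σ₃ * w₂) (g1 : r₂ = σ₁ * w₃ + c * σ₃ * w₁)
    (g2 : r₃ = a * σ₁ * w₂ + σ₂ * w₁) {L₁ L₂ L₃ R₁ R₂ R₃ : ℂ[X]}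
    (hL₁ : L₁ = Polynomial.X - Polynomial.C w₁) (hL₂ : L₂ = Polynomial.X - Polynomial.C w₂)
    (hL₃ : L₃ = Polynomial.X - Polynomial.C w₃) (hR₁ : R₁ = Polynomial.X - Polynomial.C r₁)
    (hR₂ : R₂ = Polynomial.X - Polynomial.C r₂) (hR₃ : R₃ = Polynomial.X - Polynomial.C r₃)
    (hx : R₁ = Polynomial.C (b * σ₂) * L₃ + Polynomial.C σ₃ * L₂)
    (hy : R₂ = Polynomial.C σ₁ * L₃ + Polynomial.C (c * σ₃) * L₁)
    (hz : R₃ = Polynomial.C (a * σ₁) * L₂ + Polynomial.C σ₂ * L₁) :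
    aeval ![L₂ * R₂ * (L₃ * R₃), L₁ * R₁ * (L₃ * R₃), L₁ * R₁ * (L₂ * R₂)] F = 0 := by
  set N : Fin 3 → ℂ[X] := ![L₂ * R₂ * (L₃ * R₃), L₁ * R₁ * (L₃ * R₃), L₁ * R₁ * (L₂ * R₂)]
    with hN
  by_contra hne
  have d₁ : (L₁ * R₁ * L₁) ^ 3 ∣ aeval N F := by
    refine (h 0).pow_dvd (a := L₂ * R₂ * (L₃ * R₃)) (b := L₁ * R₁ * (L₂ * R₂))
      (c := ![0, L₁ * R₁ * (L₃ * R₃ - Polynomial.C a * (L₂ * R₂)), 0]) (x := L₁ * R₁)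
      (fun i => ?_) (dvd_mul_right _ _) (fun i => ?_) (dvd_mul_right _ _) ?_
    · fin_cases i
      · simp [hN, normalPoints, normalDirections]
      · simp [hN, normalPoints, normalDirections]; ring
      · simp [hN, normalPoints, normalDirections]
    · fin_cases i
      · exact dvd_zero _
      · refine mul_dvd_mul_left _
          ⟨Polynomial.C σ₂ * L₃ - Polynomial.C (a * c * σ₃) * L₂, ?_⟩
        rw [hy, hz]
        simp only [map_mul]
        ring
      · exact dvd_zero _
    · rw [sq]
      exact mul_dvd_mul_left _ (dvd_mul_right _ _)
  have d₂ : (L₂ * R₂ * L₂) ^ 3 ∣ aeval N F := by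
    refine (h 1).pow_dvd (a := L₁ * R₁ * (L₃ * R₃)) (b := L₂ * R₂ * (L₃ * R₃))
      (c := ![0, 0, L₂ * R₂ * (L₁ * R₁ - Polynomial.C b * (L₃ * R₃))]) (x := L₂ * R₂)
      (fun i => ?_) (dvd_mul_right _ _) (fun i => ?_) (dvd_mul_right _ _) ?_
    · fin_cases i
      · simp [hN, normalPoints, normalDirections]
      · simp [hN, normalPoints, normalDirections]
      · simp [hN, normalPoints, normalDirections]; ring
    · fin_cases i
      · exact dvd_zero _
      · exact dvd_zero _
      · refine mul_dvd_mul_left _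
          ⟨Polynomial.C σ₃ * L₁ - Polynomial.C (a * b * σ₁) * L₃, ?_⟩
        rw [hx, hz]
        simp only [map_mul]
        ring
    · rw [sq]
      exact mul_dvd_mul_left _ (dvd_mul_right _ _)
  have d₃ : (L₃ * R₃ * L₃) ^ 3 ∣ aeval N F := by
    refine (h 2).pow_dvd (a := L₁ * R₁ * (L₂ * R₂)) (b := L₃ * R₃ * (L₁ * R₁))
      (c := ![L₃ * R₃ * (L₂ * R₂ - Polynomial.C c * (L₁ * R₁)), 0, 0]) (x := L₃ * R₃)
      (fun i => ?_) (dvd_mul_right _ _) (fun i => ?_) (dvd_mul_right _ _) ?_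
    · fin_cases i
      · simp [hN, normalPoints, normalDirections]; ring
      · simp [hN, normalPoints, normalDirections]; ring
      · simp [hN, normalPoints, normalDirections]
    · fin_cases i
      · refine mul_dvd_mul_left _
          ⟨Polynomial.C σ₁ * L₂ - Polynomial.C (b * c * σ₂) * L₁, ?_⟩
        rw [hx, hy]
        simp only [map_mul]
        ring
      · exact dvd_zero _
      · exact dvd_zero _
    · rw [sq]
      exact mul_dvd_mul_left _ (dvd_mul_right _ _)
  have hsupp : ∀ m ∈ F.support, ∀ i, m i ≤ 5 := by
    intro m hm i
    fin_cases i
    · exact (h 0).degreeOf_le hF (i := 0) (fun j hj => by fin_cases j <;> simp_all [normalPoints]) hm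
    · exact (h 1).degreeOf_le hF (i := 1) (fun j hj => by fin_cases j <;> simp_all [normalPoints]) hm
    · exact (h 2).degreeOf_le hF (i := 2) (fun j hj => by fin_cases j <;> simp_all [normalPoints]) hm
  obtain ⟨G, hG⟩ := mul_pow_dvd_aeval hF hsupp (L₁ * R₁) (L₂ * R₂) (L₃ * R₃)
  rw [← hN] at hG
  have n₁ : L₁ ≠ 0 := hL₁ ▸ Polynomial.X_sub_C_ne_zero w₁
  have n₂ : L₂ ≠ 0 := hL₂ ▸ Polynomial.X_sub_C_ne_zero w₂
  have n₃ : L₃ ≠ 0 := hL₃ ▸ Polynomial.X_sub_C_ne_zero w₃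
  have m₁ : R₁ ≠ 0 := hR₁ ▸ Polynomial.X_sub_C_ne_zero r₁
  have m₂ : R₂ ≠ 0 := hR₂ ▸ Polynomial.X_sub_C_ne_zero r₂
  have m₃ : R₃ ≠ 0 := hR₃ ▸ Polynomial.X_sub_C_ne_zero r₃
  have k₁ : L₁ ^ 3 ∣ G := by
    rw [hG] at d₁
    have : L₁ ^ 3 ∣ (L₂ * R₂ * (L₃ * R₃)) ^ 3 * G := by
      refine (mul_dvd_mul_iff_left (pow_ne_zero 3 (mul_ne_zero n₁ m₁))).1 ?_
      convert d₁ using 1 <;> ring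
    rw [hL₁] at this ⊢
    refine X_sub_C_pow_dvd_of_mul ?_ this
    rw [hy, hz, hL₁, hL₂, hL₃]
    simp [sub_eq_zero, h₁, ha, h₁₂, h₁₃]
  have k₂ : L₂ ^ 3 ∣ G := by
    rw [hG] at d₂
    have : L₂ ^ 3 ∣ (L₁ * R₁ * (L₃ * R₃)) ^ 3 * G := by
      refine (mul_dvd_mul_iff_left (pow_ne_zero 3 (mul_ne_zero n₂ m₂))).1 ?_
      convert d₂ using 1 <;> ring
    rw [hL₂] at this ⊢
    refine X_sub_C_pow_dvd_of_mul ?_ this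
    rw [hx, hz, hL₁, hL₂, hL₃]
    simp [sub_eq_zero, h₂, hb, h₁₂.symm, h₂₃]
  have k₃ : L₃ ^ 3 ∣ G := by
    rw [hG] at d₃
    have : L₃ ^ 3 ∣ (L₁ * R₁ * (L₂ * R₂)) ^ 3 * G := by
      refine (mul_dvd_mul_iff_left (pow_ne_zero 3 (mul_ne_zero n₃ m₃))).1 ?_
      convert d₃ using 1 <;> ring
    rw [hL₃] at this ⊢
    refine X_sub_C_pow_dvd_of_mul ?_ this
    rw [hx, hy, hL₁, hL₂, hL₃]
    simp [sub_eq_zero, h₃, hc, h₁₃.symm, h₂₃.symm]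
  have hco : ∀ {v w : ℂ}, v ≠ w → IsCoprime ((Polynomial.X - Polynomial.C v) ^ 3)
      ((Polynomial.X - Polynomial.C w) ^ 3) := fun hvw =>
    (Polynomial.isCoprime_X_sub_C_of_isUnit_sub (sub_ne_zero.2 hvw).isUnit).pow
  have hdvd : (L₁ * R₁ * (L₂ * R₂) * (L₃ * R₃)) ^ 3 * (L₁ ^ 3 * L₂ ^ 3 * L₃ ^ 3) ∣ aeval N F := by
    rw [hG]
    refine mul_dvd_mul_left _ (IsCoprime.mul_dvd ?_ (IsCoprime.mul_dvd ?_ k₁ k₂) k₃)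
    · rw [hL₁, hL₂, hL₃]
      exact (hco h₁₃).mul_left (hco h₂₃)
    · rw [hL₁, hL₂]
      exact hco h₁₂
  have hle := Polynomial.natDegree_le_of_dvd hdvd hne
  have hdeg : ((L₁ * R₁ * (L₂ * R₂) * (L₃ * R₃)) ^ 3 * (L₁ ^ 3 * L₂ ^ 3 * L₃ ^ 3)).natDegree =
      27 := by
    have p₁ : L₁.natDegree = 1 := hL₁ ▸ Polynomial.natDegree_X_sub_C w₁
    have p₂ : L₂.natDegree = 1 := hL₂ ▸ Polynomial.natDegree_X_sub_C w₂
    have p₃ : L₃.natDegree = 1 := hL₃ ▸ Polynomial.natDegree_X_sub_C w₃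
    have q₁ : R₁.natDegree = 1 := hR₁ ▸ Polynomial.natDegree_X_sub_C r₁
    have q₂ : R₂.natDegree = 1 := hR₂ ▸ Polynomial.natDegree_X_sub_C r₂
    have q₃ : R₃.natDegree = 1 := hR₃ ▸ Polynomial.natDegree_X_sub_C r₃
    have : (L₁ * R₁ * (L₂ * R₂) * (L₃ * R₃)) ^ 3 * (L₁ ^ 3 * L₂ ^ 3 * L₃ ^ 3) =
        (L₁ ^ 2 * R₁ * L₂ ^ 2 * R₂ * L₃ ^ 2 * R₃) ^ 3 := by ring
    rw [this, Polynomial.natDegree_pow, Polynomial.natDegree_mul, Polynomial.natDegree_mul,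
      Polynomial.natDegree_mul, Polynomial.natDegree_mul, Polynomial.natDegree_mul]
    · simp [p₁, p₂, p₃, q₁, q₂, q₃]
    all_goals simp [n₁, n₂, n₃, m₁, m₂, m₃]
  rw [hdeg] at hle
  -- The contact at the unit point, which is the image of `∞`.
  set W := w₁ + w₂ + w₃ with hW
  have hinf := (h 3).natDegree_add_le (D := 4) (k := 2) (g := N)
    (a := (Polynomial.X ^ 2 - Polynomial.C W * Polynomial.X) ^ 2 +
      (Polynomial.X ^ 2 - Polynomial.C W * Polynomial.X) * Polynomial.X *
        Polynomial.C (u 0 + u 1 + u 2))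
    (b := -((Polynomial.X ^ 2 - Polynomial.C W * Polynomial.X) * Polynomial.X))
    (c := ![Polynomial.C (u 1 * u 2 + w₂ * r₂ + w₃ * r₃) * Polynomial.X ^ 2 +
        Polynomial.C (u 1 * (w₃ * r₃) + u 2 * (w₂ * r₂) - W * (w₂ * r₂ + w₃ * r₃)) * Polynomial.X +
        Polynomial.C (w₂ * r₂ * (w₃ * r₃)),
      Polynomial.C (u 0 * u 2 + w₁ * r₁ + w₃ * r₃) * Polynomial.X ^ 2 +
        Polynomial.C (u 0 * (w₃ * r₃) + u 2 * (w₁ * r₁) - W * (w₁ * r₁ + w₃ * r₃)) * Polynomial.X +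
        Polynomial.C (w₁ * r₁ * (w₃ * r₃)),
      Polynomial.C (u 0 * u 1 + w₁ * r₁ + w₂ * r₂) * Polynomial.X ^ 2 +
        Polynomial.C (u 0 * (w₂ * r₂) + u 1 * (w₁ * r₁) - W * (w₁ * r₁ + w₂ * r₂)) * Polynomial.X +
        Polynomial.C (w₁ * r₁ * (w₂ * r₂))])
    hF ?_ (by compute_degree) (by
      rw [Polynomial.natDegree_neg]
      have : ((Polynomial.X ^ 2 - Polynomial.C W * Polynomial.X) *
        Polynomial.X : ℂ[X]).natDegree ≤ 3 := by compute_degree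
      lia) ?_ one_le_two le_rfl hne
  · lia
  · have hB : ∀ {w r v : ℂ} {L R : ℂ[X]}, L = Polynomial.X - Polynomial.C w →
        R = Polynomial.X - Polynomial.C r → -(w + r) = -W + v →
        L * R = Polynomial.X ^ 2 - Polynomial.C W * Polynomial.X +
          Polynomial.X * Polynomial.C v + Polynomial.C w * Polynomial.C r := by
      rintro w r v - - rfl rfl hv
      have := congrArg Polynomial.C hv
      simp only [map_add, map_neg] at this
      linear_combination Polynomial.X * this
    have bx := hB hL₁ hR₁ (v := u 0)
      (by rw [f0, g0, hW]; linear_combination -(w₂ + w₃) * e0)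
    have bY := hB hL₂ hR₂ (v := u 1)
      (by rw [f1, g1, hW]; linear_combination -(w₁ + w₃) * e1)
    have bz := hB hL₃ hR₃ (v := u 2)
      (by rw [f2, g2, hW]; linear_combination -(w₁ + w₂) * e2)
    intro i
    rw [hN, bx, bY, bz]
    fin_cases i
    · simp [normalPoints, normalDirections]; ring
    · simp [normalPoints, normalDirections]; ring
    · simp [normalPoints, normalDirections]; ring
  · have hq : ∀ p q r : ℂ, (Polynomial.C p * Polynomial.X ^ 2 + Polynomial.C q * Polynomial.X +
        Polynomial.C r : ℂ[X]).natDegree + 2 ≤ 4 := fun p q r =>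
      Nat.add_le_add_right Polynomial.natDegree_quadratic_le 2
    intro i
    refine Or.inr ?_
    fin_cases i
    · exact hq _ _ _
    · exact hq _ _ _
    · exact hq _ _ _

/-- For four `[3;3]`-points of an octic in normal form, the points `(0, 1, a)`, `(b, 0, 1)`,
`(1, c, 0)` which correspond to the directions at the coordinate points are collinear. Otherwise the
octic contains the quartic of `aeval_eq_zero_of_parametrization`. If `r₁` differs from `r₂` and `r₃`,
the quartic has at `r₁` a branch through the first coordinate point which is not contained in the
octic; by symmetry all `rᵢ` agree, but then the points are collinear after all. -/
lemma normal_relation {F : MvPolynomial (Fin 3) ℂ} (hF : IsPlaneCurve 8 F) {a b c : ℂ}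
    {u : Fin 3 → ℂ}
    (h : ∀ i, IsTriplePoint F (normalPoints i) (normalDirections a b c u i)) :
    1 + a * b * c = 0 := by
  by_contra habc
  obtain ⟨σ₁, σ₂, σ₃, w₁, w₂, w₃, h₁, h₂, h₃, h₁₂, h₁₃, h₂₃, e0, e1, e2, f0, f1, f2⟩ :=
    exists_coefficients hF h habc
  have ha : a ≠ 0 := by
    have := (h 0).det3_tangent_ne_zero le_rfl hF (h 2)
      (linearIndependent_normalPoints 0 2 (by decide))
    simpa [det3_eq, normalPoints, normalDirections] using this
  have hb : b ≠ 0 := by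
    have := (h 1).det3_tangent_ne_zero le_rfl hF (h 0)
      (linearIndependent_normalPoints 1 0 (by decide))
    simpa [det3_eq, normalPoints, normalDirections] using this
  have hc : c ≠ 0 := by
    have := (h 2).det3_tangent_ne_zero le_rfl hF (h 1)
      (linearIndependent_normalPoints 2 1 (by decide))
    simpa [det3_eq, normalPoints, normalDirections] using this
  obtain ⟨L₁, hL₁⟩ : ∃ L, L = Polynomial.X - Polynomial.C w₁ := ⟨_, rfl⟩
  obtain ⟨L₂, hL₂⟩ : ∃ L, L = Polynomial.X - Polynomial.C w₂ := ⟨_, rfl⟩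
  obtain ⟨L₃, hL₃⟩ : ∃ L, L = Polynomial.X - Polynomial.C w₃ := ⟨_, rfl⟩
  obtain ⟨r₁, g0⟩ : ∃ r, r = b * σ₂ * w₃ + σ₃ * w₂ := ⟨_, rfl⟩
  obtain ⟨r₂, g1⟩ : ∃ r, r = σ₁ * w₃ + c * σ₃ * w₁ := ⟨_, rfl⟩
  obtain ⟨r₃, g2⟩ : ∃ r, r = a * σ₁ * w₂ + σ₂ * w₁ := ⟨_, rfl⟩
  obtain ⟨R₁, hR₁⟩ : ∃ R, R = Polynomial.X - Polynomial.C r₁ := ⟨_, rfl⟩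
  obtain ⟨R₂, hR₂⟩ : ∃ R, R = Polynomial.X - Polynomial.C r₂ := ⟨_, rfl⟩
  obtain ⟨R₃, hR₃⟩ : ∃ R, R = Polynomial.X - Polynomial.C r₃ := ⟨_, rfl⟩
  have hx : R₁ = Polynomial.C (b * σ₂) * L₃ + Polynomial.C σ₃ * L₂ := by
    have e := congrArg Polynomial.C e0
    simp only [map_add, map_mul, map_one] at e
    rw [hR₁, hL₂, hL₃, g0]
    simp only [map_add, map_mul]
    linear_combination -Polynomial.X * e
  have hy : R₂ = Polynomial.C σ₁ * L₃ + Polynomial.C (c * σ₃) * L₁ := by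
    have e := congrArg Polynomial.C e1
    simp only [map_add, map_mul, map_one] at e
    rw [hR₂, hL₁, hL₃, g1]
    simp only [map_add, map_mul]
    linear_combination -Polynomial.X * e
  have hz : R₃ = Polynomial.C (a * σ₁) * L₂ + Polynomial.C σ₂ * L₁ := by
    have e := congrArg Polynomial.C e2
    simp only [map_add, map_mul, map_one] at e
    rw [hR₃, hL₁, hL₂, g2]
    simp only [map_add, map_mul]
    linear_combination -Polynomial.X * e
  have h0 := aeval_eq_zero_of_parametrization hF.1 (fun i => (h i).vanishesAt) ha hb hc h₁ h₂ h₃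
    h₁₂ h₁₃ h₂₃ e0 e1 e2 f0 f1 f2 g0 g1 g2 hL₁ hL₂ hL₃ hR₁ hR₂ hR₃ hx hy hz
  have n₁ : L₁ ≠ 0 := hL₁ ▸ Polynomial.X_sub_C_ne_zero w₁
  have n₂ : L₂ ≠ 0 := hL₂ ▸ Polynomial.X_sub_C_ne_zero w₂
  have n₃ : L₃ ≠ 0 := hL₃ ▸ Polynomial.X_sub_C_ne_zero w₃
  have m₁ : R₁ ≠ 0 := hR₁ ▸ Polynomial.X_sub_C_ne_zero r₁
  have m₂ : R₂ ≠ 0 := hR₂ ▸ Polynomial.X_sub_C_ne_zero r₂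
  have m₃ : R₃ ≠ 0 := hR₃ ▸ Polynomial.X_sub_C_ne_zero r₃
  -- The second root of each coordinate of the parametrization.
  have s₁ : b * σ₂ * (r₁ - w₃) + σ₃ * (r₁ - w₂) = 0 := by
    rw [g0]; linear_combination (b * σ₂ * w₃ + σ₃ * w₂) * e0
  have s₂ : c * σ₃ * (r₂ - w₁) + σ₁ * (r₂ - w₃) = 0 := by
    rw [g1]; linear_combination (σ₁ * w₃ + c * σ₃ * w₁) * e1
  have s₃ : a * σ₁ * (r₃ - w₂) + σ₂ * (r₃ - w₁) = 0 := by
    rw [g2]; linear_combination (a * σ₁ * w₂ + σ₂ * w₁) * e2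
  obtain ⟨x₁, y₁, z₁⟩ := sub_ne_zero_of_relation (q := a * c) hb h₂ h₃ h₂₃
    (fun h => habc (by linear_combination h)) s₁
  obtain ⟨x₂, y₂, z₂⟩ := sub_ne_zero_of_relation (q := a * b) hc h₃ h₁ h₁₃.symm
    (fun h => habc (by linear_combination h)) s₂
  obtain ⟨x₃, y₃, z₃⟩ := sub_ne_zero_of_relation (q := b * c) ha h₁ h₂ h₁₂
    (fun h => habc (by linear_combination h)) s₃
  have t₁ : r₁ = r₂ ∨ r₁ = r₃ := by
    by_contra! hne
    refine (h 0).aeval_ne_zero hF.1 (w := ![0, 1, 0]) ?_ (a := L₂ * R₂ * (L₃ * R₃))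
      (b := L₂ * R₂) (c := Polynomial.C σ₂ * L₃ - Polynomial.C (a * c * σ₃) * L₂) (x := L₁)
      (y := R₁) (t := r₁) (fun i => ?_) n₁ m₁ (by simp [hR₁]) ?_ ?_ h0
    · simp [Matrix.det_fin_three, normalPoints, normalDirections]
    · fin_cases i
      · simp [normalPoints, normalDirections]
      · simp [normalPoints, normalDirections]
        rw [hy, hz]
        simp only [map_mul]
        ring
      · simp [normalPoints, normalDirections]
    · simp [hL₂, hL₃, hR₂, hR₃, sub_eq_zero, x₁, y₁, hne.1, hne.2]
    · simpa [hL₂, hL₃] using z₁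
  have t₂ : r₂ = r₃ ∨ r₂ = r₁ := by
    by_contra! hne
    refine (h 1).aeval_ne_zero hF.1 (w := ![0, 0, 1]) ?_ (a := L₁ * R₁ * (L₃ * R₃))
      (b := L₃ * R₃) (c := Polynomial.C σ₃ * L₁ - Polynomial.C (a * b * σ₁) * L₃) (x := L₂)
      (y := R₂) (t := r₂) (fun i => ?_) n₂ m₂ (by simp [hR₂]) ?_ ?_ h0
    · simp [Matrix.det_fin_three, normalPoints, normalDirections]
    · fin_cases i
      · simp [normalPoints, normalDirections]
      · simp [normalPoints, normalDirections]
      · simp [normalPoints, normalDirections]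
        rw [hx, hz]
        simp only [map_mul]
        ring
    · simp [hL₁, hL₃, hR₁, hR₃, sub_eq_zero, x₂, y₂, hne.1, hne.2]
    · simpa [hL₁, hL₃] using z₂
  have t₃ : r₃ = r₁ ∨ r₃ = r₂ := by
    by_contra! hne
    refine (h 2).aeval_ne_zero hF.1 (w := ![1, 0, 0]) ?_ (a := L₁ * R₁ * (L₂ * R₂))
      (b := L₁ * R₁) (c := Polynomial.C σ₁ * L₂ - Polynomial.C (b * c * σ₂) * L₁) (x := L₃)
      (y := R₃) (t := r₃) (fun i => ?_) n₃ m₃ (by simp [hR₃]) ?_ ?_ h0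
    · simp [Matrix.det_fin_three, normalPoints, normalDirections]
    · fin_cases i
      · simp [normalPoints, normalDirections]
        rw [hx, hy]
        simp only [map_mul]
        ring
      · simp [normalPoints, normalDirections]
        ring
      · simp [normalPoints, normalDirections]
    · simp [hL₁, hL₂, hR₁, hR₂, sub_eq_zero, x₃, y₃, hne.1, hne.2]
    · simpa [hL₁, hL₂] using z₃
  obtain ⟨hr₂, hr₃⟩ : r₂ = r₁ ∧ r₃ = r₁ := by grind
  rw [hr₂] at s₂ x₂ y₂
  rw [hr₃] at s₃
  -- Now all three roots agree, and the product of the three equations gives the relation.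
  refine habc (mul_left_cancel₀ (mul_ne_zero (mul_ne_zero (mul_ne_zero h₁ h₂) h₃)
    (mul_ne_zero (mul_ne_zero (sub_ne_zero.2 y₂) (sub_ne_zero.2 x₁)) (sub_ne_zero.2 y₁))) ?_)
  linear_combination (c * σ₃ * (r₁ - w₁)) * (a * σ₁ * (r₁ - w₂)) * s₁ -
    (σ₃ * (r₁ - w₂)) * (a * σ₁ * (r₁ - w₂)) * s₂ + (σ₃ * (r₁ - w₂)) * (σ₁ * (r₁ - w₃)) * s₃

/-! ### Four `[3;3]`-points of an octic -/

/-- Among four `[3;3]`-points of an octic, the distinguished tangents at any three satisfy a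
relation which does not involve the fourth point. -/
lemma det3_relation {F : MvPolynomial (Fin 3) ℂ} (hF : IsPlaneCurve 8 F)
    {P₁ u₁ P₂ u₂ P₃ u₃ P₄ u₄ : Fin 3 → ℂ} (h₁ : IsTriplePoint F P₁ u₁)
    (h₂ : IsTriplePoint F P₂ u₂) (h₃ : IsTriplePoint F P₃ u₃) (h₄ : IsTriplePoint F P₄ u₄)
    (h₁₂ : LinearIndependent ℂ ![P₁, P₂]) (h₁₃ : LinearIndependent ℂ ![P₁, P₃])
    (h₂₃ : LinearIndependent ℂ ![P₂, P₃]) (h₁₄ : LinearIndependent ℂ ![P₁, P₄])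
    (h₂₄ : LinearIndependent ℂ ![P₂, P₄]) (h₃₄ : LinearIndependent ℂ ![P₃, P₄]) :
    det3 P₁ u₁ P₂ * det3 P₂ u₂ P₃ * det3 P₃ u₃ P₁ =
      det3 P₁ u₁ P₃ * det3 P₃ u₃ P₂ * det3 P₂ u₂ P₁ := by
  have hδ := h₁.det3_ne_zero le_rfl hF h₂ h₃ h₁₂ h₁₃ h₂₃
  have hx := h₂.det3_ne_zero le_rfl hF h₃ h₄ h₂₃ h₂₄ h₃₄
  have hy := h₁.det3_ne_zero le_rfl hF h₃ h₄ h₁₃ h₁₄ h₃₄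
  have hz := h₁.det3_ne_zero le_rfl hF h₂ h₄ h₁₂ h₁₄ h₂₄
  have hp := h₁.det3_tangent_ne_zero le_rfl hF h₂ h₁₂
  have hq := h₂.det3_tangent_ne_zero le_rfl hF h₃ h₂₃
  have hr := h₃.det3_tangent_ne_zero le_rfl hF h₁ (LinearIndependent.pair_symm_iff.1 h₁₃)
  obtain ⟨x, y, z, rfl⟩ := exists_eq_smul_add hδ P₄
  obtain ⟨p₀, p₁, p₂, rfl⟩ := exists_eq_smul_add hδ u₁
  obtain ⟨q₀, q₁, q₂, rfl⟩ := exists_eq_smul_add hδ u₂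
  obtain ⟨r₀, r₁, r₂, rfl⟩ := exists_eq_smul_add hδ u₃
  have d : ∀ s t v : ℂ, det3 P₂ P₃ (s • P₁ + t • P₂ + v • P₃) = s * det3 P₁ P₂ P₃ ∧
      det3 P₁ P₃ (s • P₁ + t • P₂ + v • P₃) = -t * det3 P₁ P₂ P₃ ∧
      det3 P₁ P₂ (s • P₁ + t • P₂ + v • P₃) = v * det3 P₁ P₂ P₃ ∧
      det3 P₁ (s • P₁ + t • P₂ + v • P₃) P₂ = -v * det3 P₁ P₂ P₃ ∧
      det3 P₁ (s • P₁ + t • P₂ + v • P₃) P₃ = t * det3 P₁ P₂ P₃ ∧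
      det3 P₂ (s • P₁ + t • P₂ + v • P₃) P₁ = v * det3 P₁ P₂ P₃ ∧
      det3 P₂ (s • P₁ + t • P₂ + v • P₃) P₃ = -s * det3 P₁ P₂ P₃ ∧
      det3 P₃ (s • P₁ + t • P₂ + v • P₃) P₁ = -t * det3 P₁ P₂ P₃ ∧
      det3 P₃ (s • P₁ + t • P₂ + v • P₃) P₂ = s * det3 P₁ P₂ P₃ := by
    intro s t v
    simp only [det3_eq, Pi.add_apply, Pi.smul_apply, smul_eq_mul]
    refine ⟨?_, ?_, ?_, ?_, ?_, ?_, ?_, ?_, ?_⟩ <;> ring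
  simp only [d] at hx hy hz hp hq hr ⊢
  replace hx := left_ne_zero_of_mul hx
  replace hy := neg_ne_zero.1 (left_ne_zero_of_mul hy)
  replace hz := left_ne_zero_of_mul hz
  replace hp := neg_ne_zero.1 (left_ne_zero_of_mul hp)
  replace hq := neg_ne_zero.1 (left_ne_zero_of_mul hq)
  replace hr := neg_ne_zero.1 (left_ne_zero_of_mul hr)
  set M := frame (x • P₁) (y • P₂) (z • P₃) with hM
  have hdet : M.det ≠ 0 := by
    have : M.det = x * y * z * det3 P₁ P₂ P₃ := by
      rw [hM, det_frame]
      simp only [det3_eq, Pi.smul_apply, smul_eq_mul]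
      ring
    rw [this]
    exact mul_ne_zero (mul_ne_zero (mul_ne_zero hx hy) hz) hδ
  obtain ⟨v₀, v₁, v₂, rfl⟩ := exists_coord hdet u₄
  have key := normal_relation (isPlaneCurve_pull hdet hF) (a := z * p₁ / (p₂ * y))
    (b := x * q₂ / (q₀ * z)) (c := y * r₀ / (r₁ * x)) (u := ![v₀, v₁, v₂]) (fun i => by
      refine IsTriplePoint.of_mulVec hdet ?_
      fin_cases i
      · refine h₁.change (a := x) (b := -(z / p₂) * p₀) (c := z / p₂) hx (div_ne_zero hz hp) ?_ ?_
        · simp [normalPoints, hM, frame_mulVec]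
        · simp only [normalDirections, hM, frame_mulVec, Matrix.cons_val, Fin.zero_eta]
          funext i
          simp only [Pi.add_apply, Pi.smul_apply, smul_eq_mul]
          field_simp
          ring
      · refine h₂.change (a := y) (b := -(x / q₀) * q₁) (c := x / q₀) hy (div_ne_zero hx hq) ?_ ?_
        · simp [normalPoints, hM, frame_mulVec]
        · simp only [normalDirections, hM, frame_mulVec, Matrix.cons_val, Fin.mk_one]
          funext i
          simp only [Pi.add_apply, Pi.smul_apply, smul_eq_mul]
          field_simp
          ring
      · refine h₃.change (a := z) (b := -(y / r₁) * r₂) (c := y / r₁) hz (div_ne_zero hy hr) ?_ ?_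
        · simp [normalPoints, hM, frame_mulVec]
        · simp only [normalDirections, hM, frame_mulVec, Matrix.cons_val, Fin.reduceFinMk]
          funext i
          simp only [Pi.add_apply, Pi.smul_apply, smul_eq_mul]
          field_simp
          ring
      · have : M.mulVec ![1, 1, 1] = x • P₁ + y • P₂ + z • P₃ := by
          rw [hM, frame_mulVec]
          simp
        exact this.symm ▸ h₄)
  field_simp at key
  linear_combination (-det3 P₁ P₂ P₃ ^ 3) * key

/-- If directions at four `[3;3]`-points in normal form are represented by vectors such that
`det3 Pᵢ uᵢ Pⱼ = det3 Pⱼ uⱼ Pᵢ` whenever `i = 0`, then this symmetry holds for all `i`, `j`, and it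
yields a conic which is excluded by `not_conic_of_isTriplePoint`. -/
lemma not_isTriplePoint_of_symmetric {F : MvPolynomial (Fin 3) ℂ} (hF : IsPlaneCurve 8 F)
    {u : Fin 4 → Fin 3 → ℂ} (h : ∀ i, IsTriplePoint F (normalPoints i) (u i))
    (hs : ∀ j, det3 (normalPoints j) (u j) (normalPoints 0) =
      det3 (normalPoints 0) (u 0) (normalPoints j)) : False := by
  have hLI := linearIndependent_normalPoints
  have hD : ∀ i j, i ≠ j → det3 (normalPoints i) (u i) (normalPoints j) ≠ 0 := fun i j hij =>
    (h i).det3_tangent_ne_zero le_rfl hF (h j) (hLI i j hij)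
  have hrel : ∀ j k l : Fin 4, 0 ≠ j → 0 ≠ k → j ≠ k → 0 ≠ l → j ≠ l → k ≠ l →
      det3 (normalPoints j) (u j) (normalPoints k) =
        det3 (normalPoints k) (u k) (normalPoints j) := by
    intro j k l hj hk hjk hl hjl hkl
    have := det3_relation hF (h 0) (h j) (h k) (h l) (hLI _ _ hj) (hLI _ _ hk) (hLI _ _ hjk)
      (hLI _ _ hl) (hLI _ _ hjl) (hLI _ _ hkl)
    rw [hs j, hs k] at this
    refine mul_left_cancel₀ (mul_ne_zero (hD 0 j hj) (hD 0 k hk)) ?_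
    linear_combination this
  have s₁ := hs 1
  have s₂ := hs 2
  have s₃ := hs 3
  have s₁₂ := hrel 1 2 3 (by decide) (by decide) (by decide) (by decide) (by decide) (by decide)
  have s₁₃ := hrel 1 3 2 (by decide) (by decide) (by decide) (by decide) (by decide) (by decide)
  have s₂₃ := hrel 2 3 1 (by decide) (by decide) (by decide) (by decide) (by decide) (by decide)
  have n₁ := hD 0 1 (by decide)
  have n₂ := hD 1 0 (by decide)
  simp only [det3_eq, normalPoints, Matrix.cons_val] at s₁ s₂ s₃ s₁₂ s₁₃ s₂₃
  have hl : ![u 1 0, -u 0 1, u 0 2] ≠ 0 := by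
    intro h0
    refine n₁ ?_
    have : u 0 2 = 0 := congrFun h0 2
    simp [det3_eq, normalPoints, this]
  have hsum : u 1 0 - u 0 1 + u 0 2 = 0 := by
    linear_combination (1 / 2) * (s₁ + s₂ + s₃ - s₁₂ - s₁₃ - s₂₃)
  refine not_conic_of_isTriplePoint hF (isPlaneCurve_vertexConic hl) h hLI (i := 0) (j := 1)
    (by decide) (vanishesAt_vertexConic hl n₁ ?_ ?_) (vanishesAt_vertexConic hl n₂ ?_ ?_)
    fun k => ?_
  · simp [normalPoints]
  · simp [normalPoints]
    ring
  · simp [normalPoints]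
  · simp [normalPoints]
    linear_combination u 1 0 * s₁
  · rw [eval_vertexConic]
    fin_cases k
    · simp [normalPoints]
    · simp [normalPoints]
    · simp [normalPoints]
    · simp [normalPoints]
      linear_combination hsum

/-- An octic does not have four `[3;3]`-points. -/
lemma not_four_isTriplePoint {F : MvPolynomial (Fin 3) ℂ} (hF : IsPlaneCurve 8 F)
    {P u : Fin 4 → Fin 3 → ℂ} (h : ∀ i, IsTriplePoint F (P i) (u i))
    (hP : ∀ i j, i ≠ j → LinearIndependent ℂ ![P i, P j]) : False := by
  have hδ : ∀ i j k, i ≠ j → i ≠ k → j ≠ k → det3 (P i) (P j) (P k) ≠ 0 :=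
    fun i j k hij hik hjk =>
      (h i).det3_ne_zero le_rfl hF (h j) (h k) (hP i j hij) (hP i k hik) (hP j k hjk)
  obtain ⟨x, y, z, hP₄⟩ := exists_eq_smul_add (hδ 0 1 2 (by decide) (by decide) (by decide)) (P 3)
  have hx : x ≠ 0 := by
    rintro rfl
    refine hδ 1 2 3 (by decide) (by decide) (by decide) ?_
    simp only [hP₄, det3_eq, Pi.add_apply, Pi.smul_apply, smul_eq_mul]
    ring
  have hy : y ≠ 0 := by
    rintro rfl
    refine hδ 0 2 3 (by decide) (by decide) (by decide) ?_
    simp only [hP₄, det3_eq, Pi.add_apply, Pi.smul_apply, smul_eq_mul]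
    ring
  have hz : z ≠ 0 := by
    rintro rfl
    refine hδ 0 1 3 (by decide) (by decide) (by decide) ?_
    simp only [hP₄, det3_eq, Pi.add_apply, Pi.smul_apply, smul_eq_mul]
    ring
  set M := frame (x • P 0) (y • P 1) (z • P 2) with hM
  have hdet : M.det ≠ 0 := by
    have : M.det = x * y * z * det3 (P 0) (P 1) (P 2) := by
      rw [hM, det_frame]
      simp only [det3_eq, Pi.smul_apply, smul_eq_mul]
      ring
    rw [this]
    exact mul_ne_zero (mul_ne_zero (mul_ne_zero hx hy) hz)
      (hδ 0 1 2 (by decide) (by decide) (by decide))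
  have hF' := isPlaneCurve_pull hdet hF
  obtain ⟨v, hv⟩ : ∃ v : Fin 4 → Fin 3 → ℂ, ∀ i, u i = M.mulVec (v i) := by
    refine ⟨fun i => M⁻¹.mulVec (u i), fun i => ?_⟩
    rw [Matrix.mulVec_mulVec, Matrix.mul_nonsing_inv _ (isUnit_iff_ne_zero.2 hdet),
      Matrix.one_mulVec]
  have h' : ∀ i, IsTriplePoint (pull M F) (normalPoints i) (v i) := by
    intro i
    refine IsTriplePoint.of_mulVec hdet ?_
    refine (h i).change (a := ![x, y, z, 1] i) (b := 0) (c := 1) ?_ one_ne_zero ?_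
      (by rw [hv]; simp)
    · fin_cases i <;> simp [hx, hy, hz]
    · fin_cases i <;> simp [normalPoints, hM, frame_mulVec, hP₄]
  have hD : ∀ i j, i ≠ j → det3 (normalPoints i) (v i) (normalPoints j) ≠ 0 := fun i j hij =>
    (h' i).det3_tangent_ne_zero le_rfl hF' (h' j) (linearIndependent_normalPoints i j hij)
  -- Rescale the directions at the other three points to obtain the symmetry with the first one.
  refine not_isTriplePoint_of_symmetric hF' (u := fun i => (if i = 0 then 1 else
    det3 (normalPoints 0) (v 0) (normalPoints i) / det3 (normalPoints i) (v i) (normalPoints 0)) •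
      v i) (fun i => ?_) fun j => ?_
  · refine (h' i).change (a := 1) (b := 0) one_ne_zero ?_ (one_smul _ _).symm
      (by rw [zero_smul, zero_add])
    split_ifs with hi
    · exact one_ne_zero
    · exact div_ne_zero (hD 0 i (Ne.symm hi)) (hD i 0 hi)
  · have hsmul : ∀ (c : ℂ) (a b d : Fin 3 → ℂ), det3 a (c • b) d = c * det3 a b d := by
      intro c a b d
      simp only [det3_eq, Pi.smul_apply, smul_eq_mul]
      ring
    rcases eq_or_ne j 0 with rfl | hj
    · rfl
    · rw [if_pos rfl, if_neg hj, hsmul, hsmul, one_mul, div_mul_cancel₀ _ (hD j 0 hj)]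

/-! ### Curves of low degree and distinct points of the projective plane -/

/-- For a curve of degree at most `4`, the weight condition forces the distinguished tangent to be
a double component. -/
lemma IsTriplePoint.five_le {d : ℕ} {F : MvPolynomial (Fin 3) ℂ} (hF : F.IsHomogeneous d)
    {P u : Fin 3 → ℂ} (h : IsTriplePoint F P u) : 5 ≤ d := by
  by_contra! hd
  obtain ⟨M, hM, -⟩ := h
  have h' : IsTriplePoint (pull M F) ![1, 0, 0] ![0, 1, 0] :=
    IsTriplePoint.of_mulVec hM.det_ne_zero
      ⟨M, hM, 1, 0, 1, one_ne_zero, one_ne_zero, rfl, rfl⟩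
  refine h'.not_sq_dvd (H := X 2) (g := fun t => ![1, t, 0]) ?_ rfl ?_ ?_
    (X_pow_dvd_of_forall_mem_support fun m hm => ?_)
  · refine continuous_pi fun i => ?_
    fin_cases i
    · exact continuous_const
    · exact continuous_id
    · exact continuous_const
  · intro t ht c h
    exact ht (by simpa using congrFun h 1)
  · intro t c
    simp
  · have h6 := hM.weight m hm
    have hs := sum_of_mem_support (isHomogeneous_pull M hF) hm
    lia

lemma linearIndependent_rep {p q : ProjPlane} (h : p ≠ q) :
    LinearIndependent ℂ ![p.rep, q.rep] := by
  rw [← Projectivization.independent_pair_iff_ne, Projectivization.independent_iff] at h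
  have e : Projectivization.rep ∘ ![p, q] = ![p.rep, q.rep] := by
    funext i
    fin_cases i <;> rfl
  rwa [e] at h

end PlaneCurves

theorem propositionA5 :
    -- a plane curve with a [3;3]-point has degree at least 5
    (∀ (d : ℕ) (F : MvPolynomial (Fin 3) ℂ), PlaneCurves.IsPlaneCurve d F →
      (∃ p : PlaneCurves.ProjPlane, PlaneCurves.IsNNPoint 3 F p) → 5 ≤ d) ∧
    -- a plane curve with three [3;3]-points has degree at least 8
    (∀ (d : ℕ) (F : MvPolynomial (Fin 3) ℂ), PlaneCurves.IsPlaneCurve d F →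
      (∃ p : Fin 3 → PlaneCurves.ProjPlane, Function.Injective p ∧
        ∀ i, PlaneCurves.IsNNPoint 3 F (p i)) → 8 ≤ d) ∧
    -- an octic contains every conic through three of its [3;3]-points in distinguished directions
    (∀ F : MvPolynomial (Fin 3) ℂ, PlaneCurves.IsPlaneCurve 8 F →
      ∀ (p : Fin 3 → PlaneCurves.ProjPlane) (L : Fin 3 → Submodule ℂ (Fin 3 → ℂ)),
        Function.Injective p →
        (∀ i, PlaneCurves.IsNNPointWithTangent 3 F (p i) (L i)) →
        ∀ Q : MvPolynomial (Fin 3) ℂ, PlaneCurves.IsPlaneCurve 2 Q →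
          (∀ i, PlaneCurves.PassesInDirection Q (p i) (L i)) → Q ∣ F) ∧
    -- no octic has four [3;3]-points
    (∀ F : MvPolynomial (Fin 3) ℂ, PlaneCurves.IsPlaneCurve 8 F →
      ¬ ∃ p : Fin 4 → PlaneCurves.ProjPlane, Function.Injective p ∧
        ∀ i, PlaneCurves.IsNNPoint 3 F (p i)) := by
  have hLI : ∀ {n : ℕ} {p : Fin n → PlaneCurves.ProjPlane}, Function.Injective p →
      ∀ i j, i ≠ j → LinearIndependent ℂ ![(p i).rep, (p j).rep] := fun hp i j hij =>
    PlaneCurves.linearIndependent_rep (hp.ne hij)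
  refine ⟨?_, ?_, ?_, ?_⟩
  · rintro d F hF ⟨p, L, hp⟩
    obtain ⟨u, hu, -⟩ := hp.exists_isTriplePoint hF.1
    exact hu.five_le hF.1
  · rintro d F hF ⟨p, hp, h⟩
    choose L hL using h
    choose u hu _ using fun i => (hL i).exists_isTriplePoint hF.1
    by_contra! hd
    exact PlaneCurves.not_three_isTriplePoint (by lia) hF (hu 0) (hu 1) (hu 2)
      (hLI hp 0 1 (by decide)) (hLI hp 0 2 (by decide)) (hLI hp 1 2 (by decide))
  · intro F hF p L hp hL Q hQ hQL
    choose u hu hu' using fun i => (hL i).exists_isTriplePoint hF.1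
    have hV := fun i => hu' i 2 Q hQ.1 (hQL i)
    exact PlaneCurves.dvd_of_vanishesAt hF hQ (hu 0) (hu 1) (hu 2)
      (hLI hp 0 1 (by decide)) (hLI hp 0 2 (by decide)) (hLI hp 1 2 (by decide))
      (hV 0) (hV 1) (hV 2)
  · rintro F hF ⟨p, hp, h⟩
    choose L hL using h
    choose u hu _ using fun i => (hL i).exists_isTriplePoint hF.1
    exact PlaneCurves.not_four_isTriplePoint hF hu (hLI hp)
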